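/- Theorem 1.2. Regard $K_{3,3}$ as a topological space (a one-dimensional cell complex). Let $f\colon K_{3,3}\to\mathbb{R}^2$ be a plane generic immersion, i.e. a continuous, locally injective map whose multiple points are only finitely many transversal double points, each of them between interior points of (not necessarily different) edges. Here a double point $p=f(x)=f(y)$, $x\neq y$, is transversal if there is a homeomorphism from an open neighbourhood of $p$ onto an open subset of $\mathbb{R}^2$ that sends $p$ to the origin and sends the images of small neighbourhoods of $x$ and of $y$ into the first and into the second coordinate axis, respectively. (This includes maps that are differentiable immersions on each edge and whose double points have linearly independent tangents.) For a subgraph $\gamma$ of $K_{3,3}$ let $c(f(\gamma))$ be the number of double points of the restriction $f|_\gamma$, and let $\Gamma_k(K_{3,3})$ be the set of all cycles with $k$ edges in $K_{3,3}$, a cycle being a subgraph homeomorphic to a circle. Then $$\sum_{\gamma\in\Gamma_4(K_{3,3})}c(f(\gamma))\equiv\sum_{\gamma\in\Gamma_6(K_{3,3})}c(f(\gamma))\equiv 1\pmod 2 .$$ -/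

import Mathlib

open Set Filter Topology

noncomputable section

namespace PlaneImmersion

/-- The Euclidean plane. -/
abbrev Plane : Type := EuclideanSpace ℝ (Fin 2)

variable {V : Type*} [Fintype V] [DecidableEq V] {G : SimpleGraph V}

/-- The point of `V → ℝ` that represents the vertex `v`: the standard basis vector. -/
def vertexPoint (v : V) : V → ℝ := Pi.single v 1

/-- The topological space of a subgraph `H`, as a subspace of `V → ℝ`: the points representing the
vertices of `H`, together with the line segment joining `u` and `v` for every edge `uv` of `H`. -/
def subgraphSpace (H : G.Subgraph) : Set (V → ℝ) :=
  vertexPoint '' H.verts ∪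
    {x | ∃ u v : V, H.Adj u v ∧ x ∈ segment ℝ (vertexPoint u) (vertexPoint v)}

/-- The finite graph `G` considered as a topological space (one-dimensional cell complex). -/
def graphSpace (G : SimpleGraph V) : Set (V → ℝ) := subgraphSpace (⊤ : G.Subgraph)

/-- The crossings of the restriction of `f` to the subgraph `H`: the points of the plane that are
attained by `f` at two different points of `H`. -/
def crossings (f : graphSpace G → Plane) (H : G.Subgraph) : Set Plane :=
  {p | ∃ x y : graphSpace G, x.1 ∈ subgraphSpace H ∧ y.1 ∈ subgraphSpace H ∧
    x ≠ y ∧ f x = p ∧ f y = p}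

/-- `c(f(H))`, the number of crossings of the restriction of `f` to the subgraph `H`. -/
def crossingNumber (f : graphSpace G → Plane) (H : G.Subgraph) : ℕ := (crossings f H).ncard

/-- The branches of `f` at `x` and at `y` meet transversally at the common point `f x = f y`: some
homeomorphism `h` from an open neighbourhood of this point onto an open subset of the plane takes
the point to the origin, the branch at `x` into the first coordinate axis and the branch at `y` into
the second one. (When two differentiable arcs have linearly independent velocities at a common
point, such an `h` exists by the inverse function theorem.) -/
def MeetTransversally (f : graphSpace G → Plane) (x y : graphSpace G) : Prop :=
  f x = f y ∧ ∃ h : OpenPartialHomeomorph Plane Plane, f x ∈ h.source ∧ h (f x) = 0 ∧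
    (∀ᶠ z in 𝓝 x, h (f z) 1 = 0) ∧ (∀ᶠ z in 𝓝 y, h (f z) 0 = 0)

/-- `f` is a plane generic immersion of the finite graph `G`: an immersion (a continuous, locally
injective map) whose multiple points are only finitely many transversal double points between
edges, that is, between interior points of (not necessarily different) edges. -/
structure IsPlaneGenericImmersion (f : graphSpace G → Plane) : Prop where
  continuous : Continuous f
  locally_injective : ∀ x, ∃ U ∈ 𝓝 x, InjOn f U
  finitely_many : (crossings f ⊤).Finite
  double : ∀ p, (f ⁻¹' {p}).encard ≤ 2
  not_vertex : ∀ x y, x ≠ y → f x = f y → ∀ v : V, x.1 ≠ vertexPoint v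
  transversal : ∀ x y, x ≠ y → f x = f y → MeetTransversally f x y

/-- `Γ_k(G)`, the set of all `k`-cycles of `G`, a cycle being a subgraph of `G`. -/
def cyclesOfLength (G : SimpleGraph V) (k : ℕ) : Finset G.Subgraph :=
  (Set.toFinite {H : G.Subgraph |
    ∃ (v : V) (w : G.Walk v v), w.IsCycle ∧ w.length = k ∧ w.toSubgraph = H}).toFinset

end PlaneImmersion

end

/-! For disjoint edges $e,e'$ consider $(s,t)\mapsto f(e(s))-f(e'(t))$ on the unit square. Its zeros
are the crossings of $e$ with $e'$. None lies on the boundary, because a double point is never a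
vertex. A transversal zero has odd local winding number, so the winding number round the square has
the parity of the number of crossings (`locallyOdd_of_transversal`, `rectChange_eq_card`).

Each side of the square records the change of argument of one edge as seen from a vertex off that
edge, and every such change enters exactly two squares. Once one logarithm is fixed for each pair of
vertices, these changes cancel modulo 2 in the sum over all disjoint pairs. What remains is a sign
count, equal to 9. So the number of crossings between disjoint edges is odd (`sum_windings_odd`,
`IsPlaneGenericImmersion.sum_crossings_odd`).

Finally, a crossing of $e$ and $e'$ (possibly $e=e'$) is counted once for each cycle through both
edges. Among the 4-cycles, and likewise among the 6-cycles, the number of these is odd exactly when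
the edges are disjoint. Double counting reduces both sums to the odd number above
(`IsPlaneGenericImmersion.odd_sum_crossingNumber`). -/

open Set Filter Topology

noncomputable section

namespace PlaneImmersion

open Complex (exp I)
open scoped Real

/-! ### Continuous logarithms and the change of argument along a path. -/

section LogarithmicChange

/-- A nonvanishing continuous complex function on a real normed space has a logarithm. -/
theorem exists_continuous_log {E : Type*} [NormedAddCommGroup E] [NormedSpace ℝ E]
    {F : E → ℂ} (hF : Continuous F) (h0 : ∀ x, F x ≠ 0) :
    ∃ L : E → ℂ, Continuous L ∧ ∀ x, exp (L x) = F x := by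
  obtain ⟨L, ⟨-, hL⟩, -⟩ := Complex.isCoveringMap_exp.existsUnique_continuousMap_lifts
    (A := E) ⟨fun x => (⟨F x, h0 x⟩ : {z : ℂ // z ≠ 0}), by fun_prop⟩ 0 (Complex.log (F 0))
    (Subtype.ext (Complex.exp_log (h0 0)))
  exact ⟨L, L.continuous, fun x => congrArg Subtype.val (congrFun hL x)⟩

/-- A nonvanishing continuous complex function on a retract of a real normed space has a
logarithm. -/
theorem exists_continuousOn_log {E : Type*} [NormedAddCommGroup E] [NormedSpace ℝ E]
    {s : Set E} {r : E → E} (hr : Continuous r) (hrs : ∀ x, r x ∈ s) (hrid : ∀ x ∈ s, r x = x)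
    {F : E → ℂ} (hF : ContinuousOn F s) (h0 : ∀ x ∈ s, F x ≠ 0) :
    ∃ L : E → ℂ, ContinuousOn L s ∧ ∀ x ∈ s, exp (L x) = F x := by
  obtain ⟨L, hL, hLF⟩ := exists_continuous_log (F := F ∘ r) (hF.comp_continuous hr hrs)
    fun x => h0 _ (hrs x)
  exact ⟨L, hL.continuousOn, fun x hx => by simpa [hrid x hx] using hLF x⟩

/-- The clamping retraction of the line onto `[a, b]`. -/
def clamp (a b x : ℝ) : ℝ := max a (min b x)

theorem continuous_clamp (a b : ℝ) : Continuous (clamp a b) := by unfold clamp; fun_prop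

theorem clamp_mem {a b : ℝ} (hab : a ≤ b) (x : ℝ) : clamp a b x ∈ Icc a b :=
  ⟨le_max_left _ _, max_le hab (min_le_left _ _)⟩

theorem clamp_of_mem {a b x : ℝ} (hx : x ∈ Icc a b) : clamp a b x = x := by
  simp [clamp, hx.1, hx.2]

theorem exists_log_Icc {a b : ℝ} (hab : a ≤ b) {γ : ℝ → ℂ} (hγ : ContinuousOn γ (Icc a b))
    (h0 : ∀ x ∈ Icc a b, γ x ≠ 0) :
    ∃ L : ℝ → ℂ, ContinuousOn L (Icc a b) ∧ ∀ x ∈ Icc a b, exp (L x) = γ x :=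
  exists_continuousOn_log (continuous_clamp a b) (clamp_mem hab) (fun _ => clamp_of_mem) hγ h0

theorem exists_log_rect {a b c d : ℝ} (hab : a ≤ b) (hcd : c ≤ d) {F : ℝ × ℝ → ℂ}
    (hF : ContinuousOn F (Icc a b ×ˢ Icc c d)) (h0 : ∀ x ∈ Icc a b ×ˢ Icc c d, F x ≠ 0) :
    ∃ L : ℝ × ℝ → ℂ, ContinuousOn L (Icc a b ×ˢ Icc c d) ∧
      ∀ x ∈ Icc a b ×ˢ Icc c d, exp (L x) = F x :=
  exists_continuousOn_log (r := Prod.map (clamp a b) (clamp c d))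
    ((continuous_clamp a b).prodMap (continuous_clamp c d))
    (fun x => (⟨clamp_mem hab x.1, clamp_mem hcd x.2⟩ : _ ∧ _))
    (fun _ hx => Prod.ext (clamp_of_mem hx.1) (clamp_of_mem hx.2)) hF h0

/-- The change of the logarithm along `γ` from `a` to `b`. -/
def logChange (γ : ℝ → ℂ) (a b : ℝ) : ℂ :=
  (fun L : ℝ → ℂ => L b - L a) (Classical.epsilon fun L : ℝ → ℂ =>
    ContinuousOn L (Icc a b) ∧ ∀ x ∈ Icc a b, exp (L x) = γ x)

theorem isLocallyInjective_exp : IsLocallyInjective exp := fun x => by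
  obtain ⟨U, hU, hx, hi⟩ := Complex.isCoveringMap_exp.isLocalHomeomorph.isLocallyInjective x
  exact ⟨U, hU, hx, fun y hy z hz h => hi hy hz (Subtype.ext h)⟩

/-- Two continuous logarithms of one path differ by a constant, by uniqueness of lifts through the
locally injective `exp`. Hence the arbitrary choice made in `logChange` is immaterial. -/
theorem logChange_eq {γ L : ℝ → ℂ} {a b : ℝ} (hab : a ≤ b) (hL : ContinuousOn L (Icc a b))
    (hLγ : ∀ x ∈ Icc a b, exp (L x) = γ x) : logChange γ a b = L b - L a := by
  obtain ⟨h1, h2⟩ := Classical.epsilon_spec (p := fun L : ℝ → ℂ =>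
    ContinuousOn L (Icc a b) ∧ ∀ x ∈ Icc a b, exp (L x) = γ x) ⟨L, hL, hLγ⟩
  unfold logChange
  set M := Classical.epsilon fun L : ℝ → ℂ =>
    ContinuousOn L (Icc a b) ∧ ∀ x ∈ Icc a b, exp (L x) = γ x
  have ha := left_mem_Icc.2 hab
  have hb := right_mem_Icc.2 hab
  have key : EqOn M (fun x => L x + (M a - L a)) (Icc a b) := by
    refine (T2Space.isSeparatedMap exp).eqOn_of_comp_eqOn isLocallyInjective_exp
      isPreconnected_Icc h1 (by fun_prop) (fun x hx => ?_) ha (by simp)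
    simp [Complex.exp_add, Complex.exp_sub, h2 x hx, hLγ x hx, h2 a ha, hLγ a ha]
    rw [div_self, mul_one]
    rw [← hLγ a ha]
    exact Complex.exp_ne_zero _
  show M b - M a = L b - L a
  rw [key hb]
  ring

theorem exp_logChange {γ : ℝ → ℂ} {a b : ℝ} (hab : a ≤ b) (hγ : ContinuousOn γ (Icc a b))
    (h0 : ∀ x ∈ Icc a b, γ x ≠ 0) : exp (logChange γ a b) = γ b / γ a := by
  obtain ⟨L, hL, hLγ⟩ := exists_log_Icc hab hγ h0
  rw [logChange_eq hab hL hLγ, Complex.exp_sub, hLγ _ (left_mem_Icc.2 hab),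
    hLγ _ (right_mem_Icc.2 hab)]

theorem logChange_add {γ : ℝ → ℂ} {a b c : ℝ} (hab : a ≤ b) (hbc : b ≤ c)
    (hγ : ContinuousOn γ (Icc a c)) (h0 : ∀ x ∈ Icc a c, γ x ≠ 0) :
    logChange γ a b + logChange γ b c = logChange γ a c := by
  obtain ⟨L, hL, hLγ⟩ := exists_log_Icc (hab.trans hbc) hγ h0
  rw [logChange_eq (hab.trans hbc) hL hLγ,
    logChange_eq hab (hL.mono (Icc_subset_Icc_right hbc))
      fun x hx => hLγ x (Icc_subset_Icc_right hbc hx),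
    logChange_eq hbc (hL.mono (Icc_subset_Icc_left hab))
      fun x hx => hLγ x (Icc_subset_Icc_left hab hx)]
  ring

theorem logChange_congr {γ δ : ℝ → ℂ} {a b : ℝ} (h : ∀ x ∈ Icc a b, γ x = δ x) :
    logChange γ a b = logChange δ a b := by
  have : ∀ L : ℝ → ℂ, (∀ x ∈ Icc a b, exp (L x) = γ x) ↔ ∀ x ∈ Icc a b, exp (L x) = δ x :=
    fun L => forall₂_congr fun x hx => by rw [h x hx]
  simp only [logChange, this]

theorem logChange_neg {γ : ℝ → ℂ} {a b : ℝ} (hab : a ≤ b) (hγ : ContinuousOn γ (Icc a b))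
    (h0 : ∀ x ∈ Icc a b, γ x ≠ 0) : logChange (fun x => -γ x) a b = logChange γ a b := by
  obtain ⟨L, hL, hLγ⟩ := exists_log_Icc hab hγ h0
  rw [logChange_eq hab hL hLγ, logChange_eq (L := fun x => L x + π * I) hab (by fun_prop)
    fun x hx => by simp [Complex.exp_add, hLγ x hx]]
  ring

/-- The change of the logarithm of the reversed path. -/
theorem logChange_comp_reflect {γ : ℝ → ℂ} {a b : ℝ} (hab : a ≤ b) (hγ : ContinuousOn γ (Icc a b))
    (h0 : ∀ x ∈ Icc a b, γ x ≠ 0) :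
    logChange (fun x => γ (a + b - x)) a b = -logChange γ a b := by
  obtain ⟨L, hL, hLγ⟩ := exists_log_Icc hab hγ h0
  have hm : ∀ x ∈ Icc a b, a + b - x ∈ Icc a b := fun x hx =>
    ⟨by linarith [hx.2], by linarith [hx.1]⟩
  rw [logChange_eq hab hL hLγ, logChange_eq (L := fun x => L (a + b - x)) hab
    (hL.comp (by fun_prop) hm) fun x hx => hLγ _ (hm x hx)]
  simp

end LogarithmicChange

/-! ### Winding numbers round rectangles. -/

section Rectangle

/-- The change of the logarithm of `F` round the boundary of `[a, b] × [c, d]`. -/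
def rectChange (F : ℝ → ℝ → ℂ) (a b c d : ℝ) : ℂ :=
  logChange (fun s => F s c) a b + logChange (fun t => F b t) c d
    - logChange (fun s => F s d) a b - logChange (fun t => F a t) c d

/-- The boundary of a rectangle. -/
def rectBoundary (a b c d : ℝ) : Set (ℝ × ℝ) :=
  {z | z ∈ Icc a b ×ˢ Icc c d ∧ (z.1 = a ∨ z.1 = b ∨ z.2 = c ∨ z.2 = d)}

theorem rectChange_congr {F G : ℝ → ℝ → ℂ} {a b c d : ℝ} (hab : a ≤ b) (hcd : c ≤ d)
    (h : ∀ s ∈ Icc a b, ∀ t ∈ Icc c d, F s t = G s t) :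
    rectChange F a b c d = rectChange G a b c d := by
  unfold rectChange
  rw [logChange_congr fun s hs => h s hs c (left_mem_Icc.2 hcd),
    logChange_congr fun s hs => h s hs d (right_mem_Icc.2 hcd),
    logChange_congr fun t ht => h a (left_mem_Icc.2 hab) t ht,
    logChange_congr fun t ht => h b (right_mem_Icc.2 hab) t ht]

/-- Without zeros there is a single logarithm on the whole rectangle, and its increments round the
boundary telescope. -/
theorem rectChange_eq_zero {F : ℝ → ℝ → ℂ} {a b c d : ℝ} (hab : a ≤ b) (hcd : c ≤ d)
    (hF : ContinuousOn (Function.uncurry F) (Icc a b ×ˢ Icc c d))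
    (h0 : ∀ s ∈ Icc a b, ∀ t ∈ Icc c d, F s t ≠ 0) : rectChange F a b c d = 0 := by
  obtain ⟨L, hL, hLF⟩ := exists_log_rect hab hcd hF fun x hx => h0 _ hx.1 _ hx.2
  have ha := left_mem_Icc.2 hab
  have hb := right_mem_Icc.2 hab
  have hc := left_mem_Icc.2 hcd
  have hd := right_mem_Icc.2 hcd
  have hor : ∀ t ∈ Icc c d, logChange (fun s => F s t) a b = L (b, t) - L (a, t) := fun t ht =>
    logChange_eq (L := fun s => L (s, t)) hab
      (hL.comp (by fun_prop) fun s hs => ⟨hs, ht⟩) fun s hs => hLF (s, t) ⟨hs, ht⟩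
  have ver : ∀ s ∈ Icc a b, logChange (fun t => F s t) c d = L (s, d) - L (s, c) := fun s hs =>
    logChange_eq (L := fun t => L (s, t)) hcd
      (hL.comp (by fun_prop) fun t ht => ⟨hs, ht⟩) fun t ht => hLF (s, t) ⟨hs, ht⟩
  rw [rectChange, hor c hc, hor d hd, ver a ha, ver b hb]
  ring

/-- The change round the boundary is unaffected by a nonvanishing homotopy on the boundary. -/
theorem rectChange_homotopy {H : ℝ → ℝ → ℝ → ℂ} {a b c d : ℝ} (hab : a ≤ b) (hcd : c ≤ d)
    (hH : ContinuousOn (fun z : ℝ × ℝ × ℝ => H z.1 z.2.1 z.2.2)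
      (Icc 0 1 ×ˢ (Icc a b ×ˢ Icc c d)))
    (h0 : ∀ r ∈ Icc (0 : ℝ) 1, ∀ z ∈ rectBoundary a b c d, H r z.1 z.2 ≠ 0) :
    rectChange (H 0) a b c d = rectChange (H 1) a b c d := by
  have ha := left_mem_Icc.2 hab
  have hb := right_mem_Icc.2 hab
  have hc := left_mem_Icc.2 hcd
  have hd := right_mem_Icc.2 hcd
  -- Each side times the homotopy interval is a rectangle without zeros of `H`. In the signed sum of
  -- the four resulting relations the paths traced by the corners cancel.
  have hor : ∀ t ∈ Icc c d, (t = c ∨ t = d) → rectChange (fun r s => H r s t) 0 1 a b = 0 :=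
    fun t ht htt => rectChange_eq_zero zero_le_one hab
      (hH.comp (f := fun z : ℝ × ℝ => (z.1, z.2, t)) (by fun_prop) fun z hz => ⟨hz.1, hz.2, ht⟩)
      fun r hr s hs => h0 r hr (s, t) ⟨⟨hs, ht⟩, Or.inr (Or.inr htt)⟩
  have ver : ∀ s ∈ Icc a b, (s = a ∨ s = b) → rectChange (fun r t => H r s t) 0 1 c d = 0 :=
    fun s hs hss => rectChange_eq_zero zero_le_one hcd
      (hH.comp (f := fun z : ℝ × ℝ => (z.1, s, z.2)) (by fun_prop) fun z hz => ⟨hz.1, hs, hz.2⟩)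
      fun r hr t ht => h0 r hr (s, t) ⟨⟨hs, ht⟩, or_assoc.1 (Or.inl hss)⟩
  have h1 := hor c hc (Or.inl rfl)
  have h2 := hor d hd (Or.inr rfl)
  have h3 := ver a ha (Or.inl rfl)
  have h4 := ver b hb (Or.inr rfl)
  unfold rectChange at *
  linear_combination -h1 + h2 + h3 - h4

theorem mem_rectBoundary_of_fst {a b c d s t : ℝ} (hab : a ≤ b) (hs : s = a ∨ s = b)
    (ht : t ∈ Icc c d) : (s, t) ∈ rectBoundary a b c d := by
  rcases hs with rfl | rfl
  · exact ⟨⟨left_mem_Icc.2 hab, ht⟩, Or.inl rfl⟩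
  · exact ⟨⟨right_mem_Icc.2 hab, ht⟩, Or.inr (Or.inl rfl)⟩

theorem mem_rectBoundary_of_snd {a b c d s t : ℝ} (hcd : c ≤ d) (hs : s ∈ Icc a b)
    (ht : t = c ∨ t = d) : (s, t) ∈ rectBoundary a b c d := by
  rcases ht with rfl | rfl
  · exact ⟨⟨hs, left_mem_Icc.2 hcd⟩, Or.inr (Or.inr (Or.inl rfl))⟩
  · exact ⟨⟨hs, right_mem_Icc.2 hcd⟩, Or.inr (Or.inr (Or.inr rfl))⟩

/-- An odd function has odd winding number round a centrally symmetric rectangle. -/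
theorem rectChange_odd {F : ℝ → ℝ → ℂ} {a b c d : ℝ} (hab : a ≤ b) (hcd : c ≤ d)
    (hF : ContinuousOn (Function.uncurry F) (Icc a b ×ˢ Icc c d))
    (h0 : ∀ z ∈ rectBoundary a b c d, F z.1 z.2 ≠ 0)
    (hodd : ∀ s t, F (a + b - s) (c + d - t) = -F s t) :
    ∃ k : ℤ, rectChange F a b c d = (2 * k + 1 : ℤ) * (2 * π * I) := by
  have ha := left_mem_Icc.2 hab
  have hb := right_mem_Icc.2 hab
  have hc := left_mem_Icc.2 hcd
  have hd := right_mem_Icc.2 hcd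
  have hor : ContinuousOn (fun s => F s d) (Icc a b) :=
    hF.comp (f := fun s => (s, d)) (by fun_prop) fun s hs => ⟨hs, hd⟩
  have ver : ContinuousOn (fun t => F b t) (Icc c d) :=
    hF.comp (f := fun t => (b, t)) (by fun_prop) fun t ht => ⟨hb, ht⟩
  have hor0 : ∀ s ∈ Icc a b, F s d ≠ 0 := fun s hs =>
    h0 _ (mem_rectBoundary_of_snd hcd hs (Or.inr rfl))
  have ver0 : ∀ t ∈ Icc c d, F b t ≠ 0 := fun t ht =>
    h0 _ (mem_rectBoundary_of_fst hab (Or.inr rfl) ht)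
  have hm : ∀ {x a b : ℝ}, x ∈ Icc a b → a + b - x ∈ Icc a b := fun hx =>
    ⟨by linarith [hx.2], by linarith [hx.1]⟩
  -- The point reflection carries each side to the opposite one, reversed, and negates `F`. Reversal
  -- changes the sign of the logarithmic change and negation does not affect it.
  have e1 : logChange (fun s => F s c) a b = -logChange (fun s => F s d) a b := by
    rw [← logChange_comp_reflect hab hor hor0, ← logChange_neg hab
      (γ := fun s => F (a + b - s) d) (hor.comp (by fun_prop) fun x hx => hm hx)
      fun s hs => hor0 _ (hm hs)]
    refine logChange_congr fun s _ => ?_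
    have := hodd s c
    rw [add_sub_cancel_left] at this
    simp [this]
  have e2 : logChange (fun t => F a t) c d = -logChange (fun t => F b t) c d := by
    rw [← logChange_comp_reflect hcd ver ver0, ← logChange_neg hcd
      (γ := fun t => F b (c + d - t)) (ver.comp (by fun_prop) fun x hx => hm hx)
      fun t ht => ver0 _ (hm ht)]
    refine logChange_congr fun t _ => ?_
    have := hodd a t
    rw [add_sub_cancel_left] at this
    simp [this]
  -- Half of the boundary joins opposite corners, where the values of `F` are negatives of each
  -- other. Its change is thus an odd multiple of $\pi i$, and the full change is twice that.
  have e3 : exp (logChange (fun t => F b t) c d - logChange (fun s => F s d) a b - π * I) = 1 := by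
    rw [Complex.exp_sub, Complex.exp_sub, exp_logChange hab hor hor0, exp_logChange hcd ver ver0,
      Complex.exp_pi_mul_I]
    have h1 := hodd a d
    simp only [add_sub_cancel_left, add_sub_cancel_right] at h1
    have := ver0 d hd
    have := hor0 a ha
    rw [h1]
    field_simp
  obtain ⟨k, hk⟩ := Complex.exp_eq_one_iff.1 e3
  refine ⟨k, ?_⟩
  rw [rectChange, e1, e2]
  push_cast
  linear_combination 2 * hk

/-- The common side enters the two pieces with opposite signs, so it cancels even if `F` vanishes on
it; only the outer boundary must be free of zeros. -/
theorem rectChange_split_fst {F : ℝ → ℝ → ℂ} (hF : Continuous (Function.uncurry F))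
    {a m b c d : ℝ} (ham : a ≤ m) (hmb : m ≤ b) (hcd : c ≤ d)
    (h0 : ∀ z ∈ rectBoundary a b c d, F z.1 z.2 ≠ 0) :
    rectChange F a b c d = rectChange F a m c d + rectChange F m b c d := by
  have e : ∀ t, (t = c ∨ t = d) → _ := fun t ht => logChange_add (γ := fun s => F s t) ham hmb
    (hF.comp (f := fun s => (s, t)) (by fun_prop)).continuousOn
    fun s hs => h0 (s, t) (mem_rectBoundary_of_snd hcd hs ht)
  unfold rectChange
  rw [← e c (Or.inl rfl), ← e d (Or.inr rfl)]
  ring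

theorem rectChange_split_snd {F : ℝ → ℝ → ℂ} (hF : Continuous (Function.uncurry F))
    {a b c m d : ℝ} (hcm : c ≤ m) (hmd : m ≤ d) (hab : a ≤ b)
    (h0 : ∀ z ∈ rectBoundary a b c d, F z.1 z.2 ≠ 0) :
    rectChange F a b c d = rectChange F a b c m + rectChange F a b m d := by
  have e : ∀ s, (s = a ∨ s = b) → _ := fun s hs => logChange_add (γ := fun t => F s t) hcm hmd
    (hF.comp (f := fun t => (s, t)) (by fun_prop)).continuousOn
    fun t ht => h0 (s, t) (mem_rectBoundary_of_fst hab hs ht)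
  unfold rectChange
  rw [← e a (Or.inl rfl), ← e b (Or.inr rfl)]
  ring

end Rectangle

/-! ### Winding number and number of zeros modulo 2. -/

section ZeroCount

/-- The winding number of `F` round every small square centred at `(s, t)` is odd. -/
def LocallyOdd (F : ℝ → ℝ → ℂ) (s t : ℝ) : Prop :=
  ∀ᶠ δ in 𝓝[>] (0 : ℝ), ∃ k : ℤ,
    rectChange F (s - δ) (s + δ) (t - δ) (t + δ) = (2 * k + 1 : ℤ) * (2 * π * I)

theorem rectChange_of_single_zero {F : ℝ → ℝ → ℂ} (hF : Continuous (Function.uncurry F))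
    {a b c d s t : ℝ} (hs : s ∈ Ioo a b) (ht : t ∈ Ioo c d)
    (hz : ∀ x ∈ Icc a b, ∀ y ∈ Icc c d, F x y = 0 → x = s ∧ y = t) (ho : LocallyOdd F s t) :
    ∃ k : ℤ, rectChange F a b c d = (2 * k + 1 : ℤ) * (2 * π * I) := by
  have hsmall : ∀ {u : ℝ}, 0 < u → ∀ᶠ δ in 𝓝[>] (0 : ℝ), δ < u := fun hu =>
    nhdsWithin_le_nhds (Iio_mem_nhds hu)
  obtain ⟨δ, ⟨k, hk⟩, h1, h2, h3, h4, h5⟩ := (ho.and ((hsmall (sub_pos.2 hs.1)).and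
    ((hsmall (sub_pos.2 hs.2)).and ((hsmall (sub_pos.2 ht.1)).and
    ((hsmall (sub_pos.2 ht.2)).and self_mem_nhdsWithin))))).exists
  replace h5 : 0 < δ := h5
  have hs1 := hs.1
  have hs2 := hs.2
  have ht1 := ht.1
  have ht2 := ht.2
  have zero : ∀ {a' b' c' d' : ℝ}, a ≤ a' → a' ≤ b' → b' ≤ b → c ≤ c' → c' ≤ d' → d' ≤ d →
      (s ∉ Icc a' b' ∨ t ∉ Icc c' d') → rectChange F a' b' c' d' = 0 := by
    intro a' b' c' d' ha hab hb hc hcd hd hst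
    refine rectChange_eq_zero hab hcd hF.continuousOn fun x hx y hy h => ?_
    obtain ⟨rfl, rfl⟩ := hz x (Icc_subset_Icc ha hb hx) y (Icc_subset_Icc hc hd hy) h
    exact hst.elim (fun h => h hx) fun h => h hy
  have bdry : ∀ {a' b' c' d' : ℝ}, a ≤ a' → b' ≤ b → c ≤ c' → d' ≤ d →
      s ≠ a' → s ≠ b' → t ≠ c' → t ≠ d' → ∀ z ∈ rectBoundary a' b' c' d', F z.1 z.2 ≠ 0 := by
    rintro a' b' c' d' ha hb hc hd h1 h2 h3 h4 ⟨x, y⟩ ⟨⟨hx, hy⟩, hxy⟩ h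
    obtain ⟨rfl, rfl⟩ := hz x (Icc_subset_Icc ha hb hx) y (Icc_subset_Icc hc hd hy) h
    simp only at hxy
    tauto
  refine ⟨k, ?_⟩
  -- Cut along both vertical sides of the small square, then cut the middle strip along its
  -- horizontal sides. The four outer pieces contain no zero and contribute nothing.
  rw [rectChange_split_fst hF (m := s - δ) (by linarith) (by linarith) (by linarith)
      (bdry le_rfl le_rfl le_rfl le_rfl hs1.ne' hs2.ne ht1.ne' ht2.ne),
    rectChange_split_fst hF (a := s - δ) (m := s + δ) (by linarith) (by linarith) (by linarith)
      (bdry (by linarith) le_rfl le_rfl le_rfl (by linarith) hs2.ne ht1.ne' ht2.ne),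
    rectChange_split_snd hF (a := s - δ) (b := s + δ) (m := t - δ) (by linarith) (by linarith)
      (by linarith) (bdry (by linarith) (by linarith) le_rfl le_rfl (by linarith) (by linarith)
        ht1.ne' ht2.ne),
    rectChange_split_snd hF (a := s - δ) (b := s + δ) (c := t - δ) (m := t + δ) (by linarith)
      (by linarith) (by linarith) (bdry (by linarith) (by linarith) (by linarith) le_rfl
        (by linarith) (by linarith) (by linarith) ht2.ne), hk,
    zero le_rfl (by linarith) (by linarith) le_rfl (by linarith) le_rfl
      (Or.inl fun h => by linarith [h.2]),
    zero (b' := b) (by linarith) (by linarith) le_rfl le_rfl (by linarith) le_rfl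
      (Or.inl fun h => by linarith [h.1]),
    zero (c' := c) (by linarith) (by linarith) (by linarith) le_rfl (by linarith) (by linarith)
      (Or.inr fun h => by linarith [h.2]),
    zero (d' := d) (by linarith) (by linarith) (by linarith) (by linarith) (by linarith) le_rfl
      (Or.inr fun h => by linarith [h.1])]
  ring

/-- The winding number round a rectangle has the parity of the number of zeros inside. -/
theorem rectChange_eq_card {F : ℝ → ℝ → ℂ} (hF : Continuous (Function.uncurry F))
    {c d : ℝ} (hcd : c ≤ d) (n : ℕ) : ∀ {a b : ℝ}, a ≤ b → ∀ Z : Finset (ℝ × ℝ), Z.card = n →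
      (∀ z, z ∈ Z ↔ z ∈ Icc a b ×ˢ Icc c d ∧ F z.1 z.2 = 0) →
      (∀ z ∈ Z, z.1 ∈ Ioo a b ∧ z.2 ∈ Ioo c d ∧ LocallyOdd F z.1 z.2) →
      InjOn Prod.fst (Z : Set (ℝ × ℝ)) →
      ∃ k : ℤ, rectChange F a b c d = (2 * k + n : ℤ) * (2 * π * I) := by
  induction n using Nat.strong_induction_on with
  | _ n ih =>
  intro a b hab Z hZn hZ hint hinj
  rcases Nat.lt_or_ge 1 n with hn | hn
  -- Distinct zeros have distinct first coordinates, so some vertical line misses all zeros and has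
  -- at least one on each side. Both pieces then have fewer zeros.
  · obtain ⟨z, hz, w, hw, hzw⟩ : ∃ z ∈ Z, ∃ w ∈ Z, z.1 < w.1 := by
      obtain ⟨z, hz, w, hw, hne⟩ := Finset.one_lt_card.1 (hZn ▸ hn)
      rcases lt_or_gt_of_ne (fun h => hne (hinj hz hw h)) with h | h
      exacts [⟨z, hz, w, hw, h⟩, ⟨w, hw, z, hz, h⟩]
    obtain ⟨m, hm, hmZ⟩ := (Ioo_infinite hzw).exists_notMem_finset (Z.image Prod.fst)
    have hmZ' : ∀ z ∈ Z, z.1 ≠ m := fun z hz h => hmZ (Finset.mem_image.2 ⟨z, hz, h⟩)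
    have ham : a < m := (hint z hz).1.1.trans hm.1
    have hmb : m < b := hm.2.trans (hint w hw).1.2
    have hcard := Finset.card_filter_add_card_filter_not (s := Z) fun z => z.1 < m
    have h1 : 0 < (Z.filter fun z => z.1 < m).card :=
      Finset.card_pos.2 ⟨z, Finset.mem_filter.2 ⟨hz, hm.1⟩⟩
    have h2 : 0 < (Z.filter fun z => ¬ z.1 < m).card :=
      Finset.card_pos.2 ⟨w, Finset.mem_filter.2 ⟨hw, hm.2.not_gt⟩⟩
    obtain ⟨k, hk⟩ := ih _ (by omega) ham.le (Z.filter fun z => z.1 < m) rfl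
      (fun z => by
        rw [Finset.mem_filter, hZ]
        refine ⟨fun ⟨⟨h, h'⟩, hl⟩ => ⟨⟨⟨h.1.1, hl.le⟩, h.2⟩, h'⟩, fun ⟨h, h'⟩ => ?_⟩
        have hz := (hZ z).2 ⟨⟨⟨h.1.1, h.1.2.trans hmb.le⟩, h.2⟩, h'⟩
        exact ⟨(hZ z).1 hz, lt_of_le_of_ne h.1.2 (hmZ' z hz)⟩)
      (fun z hz => by
        rw [Finset.mem_filter] at hz
        exact ⟨⟨(hint z hz.1).1.1, hz.2⟩, (hint z hz.1).2⟩)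
      (hinj.mono (by simp +contextual [subset_def]))
    obtain ⟨l, hl⟩ := ih _ (by omega) hmb.le (Z.filter fun z => ¬ z.1 < m) rfl
      (fun z => by
        rw [Finset.mem_filter, hZ]
        refine ⟨fun ⟨⟨h, h'⟩, hl⟩ => ⟨⟨⟨not_lt.1 hl, h.1.2⟩, h.2⟩, h'⟩, fun ⟨h, h'⟩ => ?_⟩
        have hz := (hZ z).2 ⟨⟨⟨ham.le.trans h.1.1, h.1.2⟩, h.2⟩, h'⟩
        exact ⟨(hZ z).1 hz, not_lt.2 h.1.1⟩)
      (fun z hz => by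
        rw [Finset.mem_filter] at hz
        exact ⟨⟨lt_of_le_of_ne (not_lt.1 hz.2) (hmZ' z hz.1).symm, (hint z hz.1).1.2⟩,
          (hint z hz.1).2⟩)
      (hinj.mono (by simp +contextual [subset_def]))
    refine ⟨k + l, ?_⟩
    rw [rectChange_split_fst hF ham.le hmb.le hcd, hk, hl, ← hZn, ← hcard]
    · push_cast
      ring
    · rintro ⟨x, y⟩ ⟨hxy, hb⟩ h
      obtain ⟨h1, h2, -⟩ := hint _ ((hZ (x, y)).2 ⟨hxy, h⟩)
      simp only at hb
      rcases hb with rfl | rfl | rfl | rfl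
      exacts [h1.1.false, h1.2.false, h2.1.false, h2.2.false]
  · interval_cases n
    · rw [Finset.card_eq_zero] at hZn
      subst hZn
      refine ⟨0, ?_⟩
      rw [rectChange_eq_zero hab hcd hF.continuousOn]
      · simp
      · intro s hs t ht h
        simpa using (hZ (s, t)).2 ⟨⟨hs, ht⟩, h⟩
    · obtain ⟨z, rfl⟩ := Finset.card_eq_one.1 hZn
      obtain ⟨h1, h2, h3⟩ := hint z (Finset.mem_singleton_self z)
      refine rectChange_of_single_zero hF h1 h2 (fun x hx y hy h => ?_) h3
      have := Finset.mem_singleton.1 ((hZ (x, y)).2 ⟨⟨hx, hy⟩, h⟩)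
      simp [← this]

end ZeroCount

/-! ### Local intersection number of topologically transversal arcs. -/

section TransversalCrossing

/-- An injective function on `[s - δ, s + δ]` vanishing at `s` deforms to a linear function,
without further zeros. -/
theorem exists_deformation_to_linear {a : ℝ → ℝ} {s δ ε : ℝ} (hδ : 0 < δ)
    (ha : ContinuousOn a (Icc (s - δ) (s + δ))) (hi : InjOn a (Icc (s - δ) (s + δ)))
    (h0 : a s = 0) (hm : MapsTo a (Icc (s - δ) (s + δ)) (Ioo (-ε) ε)) :
    ∃ A : ℝ → ℝ → ℝ, A 0 = a ∧ (∀ x, A 1 (s - δ + (s + δ) - x) = -A 1 x) ∧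
      ContinuousOn (Function.uncurry A) (Icc 0 1 ×ˢ Icc (s - δ) (s + δ)) ∧
      ∀ r ∈ Icc (0 : ℝ) 1, ∀ x ∈ Icc (s - δ) (s + δ),
        A r x ∈ Ioo (-ε) ε ∧ (A r x = 0 → x = s) := by
  have hs : s ∈ Icc (s - δ) (s + δ) := ⟨by linarith, by linarith⟩
  have hε : 0 < ε := h0 ▸ (hm hs).2
  -- A continuous injective function on an interval is strictly monotone; `σ` is the sign of its
  -- direction.
  obtain ⟨σ, hσ, hlt, hgt⟩ : ∃ σ : ℝ, |σ| = 1 ∧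
      (∀ x ∈ Icc (s - δ) (s + δ), x < s → σ * a x < 0) ∧
      ∀ x ∈ Icc (s - δ) (s + δ), s < x → 0 < σ * a x := by
    rcases ha.strictMonoOn_of_injOn_Icc' (by linarith) hi with h | h
    · exact ⟨1, by simp, fun x hx hxs => by simpa [h0] using h hx hs hxs,
        fun x hx hxs => by simpa [h0] using h hs hx hxs⟩
    · exact ⟨-1, by simp, fun x hx hxs => by simpa [h0] using h hx hs hxs,
        fun x hx hxs => by simpa [h0] using h hs hx hxs⟩
  have hσ2 : σ * σ = 1 := by rw [← abs_mul_abs_self, hσ, one_mul]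
  have hκ : 0 < ε / (2 * δ) := by positivity
  -- The linear target has the same sign as `a` on each side of `s`, so convex combinations vanish
  -- only at `s`. The slope $\varepsilon/(2\delta)$ bounds it by $\varepsilon/2$.
  refine ⟨fun r x => (1 - r) * a x + r * (σ * (ε / (2 * δ)) * (x - s)), ?_, ?_, ?_, ?_⟩
  · ext x
    simp
  · intro x
    ring
  · have : ContinuousOn (fun z : ℝ × ℝ => a z.2) (Icc 0 1 ×ˢ Icc (s - δ) (s + δ)) :=
      ha.comp (by fun_prop) fun z hz => hz.2
    exact ((continuous_const.sub continuous_fst).continuousOn.mul this).add (by fun_prop)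
  · intro r hr x hx
    constructor
    · refine (convex_Ioo (-ε) ε) (hm hx) ?_ (sub_nonneg.2 hr.2) hr.1 (by ring)
      rw [mem_Ioo, ← abs_lt, abs_mul, abs_mul, hσ, one_mul, abs_of_pos hκ]
      have : |x - s| ≤ δ := abs_le.2 ⟨by linarith [hx.1], by linarith [hx.2]⟩
      calc ε / (2 * δ) * |x - s| ≤ ε / (2 * δ) * δ := by gcongr
        _ = ε / 2 := by field_simp
        _ < ε := by linarith
    · intro h
      have h' : (1 - r) * (σ * a x) + r * (ε / (2 * δ) * (x - s)) = 0 := by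
        linear_combination σ * h - r * (ε / (2 * δ) * (x - s)) * hσ2
      by_contra hne
      have hr0 := hr.1
      have hr1 := sub_nonneg.2 hr.2
      rcases lt_or_gt_of_ne hne with hl | hl
      · have h1 := hlt x hx hl
        have h2 : ε / (2 * δ) * (x - s) < 0 := mul_neg_of_pos_of_neg hκ (by linarith)
        rcases hr0.eq_or_lt with rfl | hr0
        · linarith
        · linarith [mul_neg_of_pos_of_neg hr0 h2, mul_nonpos_of_nonneg_of_nonpos hr1 h1.le]
      · have h1 := hgt x hx hl
        have h2 : 0 < ε / (2 * δ) * (x - s) := mul_pos hκ (by linarith)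
        rcases hr0.eq_or_lt with rfl | hr0
        · linarith
        · linarith [mul_pos hr0 h2, mul_nonneg hr1 h1.le]

/-- Two arcs running in the images of the coordinate axes under an embedding of a square have odd
intersection number. -/
theorem rectChange_of_axes {g : ℝ × ℝ → ℂ} {a b : ℝ → ℝ} {s t δ ε : ℝ} (hδ : 0 < δ)
    (hg : ContinuousOn g (Ioo (-ε) ε ×ˢ Ioo (-ε) ε)) (hgi : InjOn g (Ioo (-ε) ε ×ˢ Ioo (-ε) ε))
    (ha : ContinuousOn a (Icc (s - δ) (s + δ))) (hai : InjOn a (Icc (s - δ) (s + δ)))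
    (ha0 : a s = 0) (ham : MapsTo a (Icc (s - δ) (s + δ)) (Ioo (-ε) ε))
    (hb : ContinuousOn b (Icc (t - δ) (t + δ))) (hbi : InjOn b (Icc (t - δ) (t + δ)))
    (hb0 : b t = 0) (hbm : MapsTo b (Icc (t - δ) (t + δ)) (Ioo (-ε) ε)) :
    ∃ k : ℤ, rectChange (fun x y => g (a x, 0) - g (0, b y)) (s - δ) (s + δ) (t - δ) (t + δ)
      = (2 * k + 1 : ℤ) * (2 * π * I) := by
  obtain ⟨A, hA0, hA1, hAc, hA⟩ := exists_deformation_to_linear hδ ha hai ha0 ham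
  obtain ⟨B, hB0, hB1, hBc, hB⟩ := exists_deformation_to_linear hδ hb hbi hb0 hbm
  have hs : s ∈ Icc (s - δ) (s + δ) := ⟨by linarith, by linarith⟩
  have ht : t ∈ Icc (t - δ) (t + δ) := ⟨by linarith, by linarith⟩
  have hneg : ∀ {u : ℝ}, u ∈ Ioo (-ε) ε → -u ∈ Ioo (-ε) ε := fun hu =>
    ⟨by linarith [hu.2], by linarith [hu.1]⟩
  have hscale : ∀ {r u : ℝ}, r ∈ Icc (0 : ℝ) 1 → u ∈ Ioo (-ε) ε → r * u ∈ Ioo (-ε) ε := by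
    intro r u hr hu
    rw [mem_Ioo, ← abs_lt] at hu ⊢
    rw [abs_mul, abs_of_nonneg hr.1]
    nlinarith [hr.2, abs_nonneg u]
  have hbd : ∀ z ∈ rectBoundary (s - δ) (s + δ) (t - δ) (t + δ), ¬ (z.1 = s ∧ z.2 = t) := by
    rintro ⟨x, y⟩ ⟨-, h⟩ ⟨rfl, rfl⟩
    simp only at h
    rcases h with h | h | h | h <;> linarith
  have hle : s - δ ≤ s + δ := by linarith
  have hle' : t - δ ≤ t + δ := by linarith
  -- This homotopy ends at $g(a,-b)-g(-a,b)$, which changes sign when $a$ and $b$ both do. By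
  -- injectivity of `g`, a zero on the way forces $(1+r)a=(1+r)b=0$.
  have e1 := rectChange_homotopy (a := s - δ) (b := s + δ) (c := t - δ) (d := t + δ)
    (H := fun r x y => g (a x, -(r * b y)) - g (-(r * a x), b y)) hle hle' (by
      have h1 : ContinuousOn (fun z : ℝ × ℝ × ℝ => a z.2.1)
          (Icc 0 1 ×ˢ (Icc (s - δ) (s + δ) ×ˢ Icc (t - δ) (t + δ))) :=
        ha.comp (by fun_prop) fun z hz => hz.2.1
      have h2 : ContinuousOn (fun z : ℝ × ℝ × ℝ => b z.2.2)
          (Icc 0 1 ×ˢ (Icc (s - δ) (s + δ) ×ˢ Icc (t - δ) (t + δ))) :=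
        hb.comp (by fun_prop) fun z hz => hz.2.2
      refine (hg.comp (f := fun z : ℝ × ℝ × ℝ => (a z.2.1, -(z.1 * b z.2.2)))
        (h1.prodMk (continuousOn_fst.mul h2).neg)
        fun z hz => ?_).sub (hg.comp (f := fun z : ℝ × ℝ × ℝ => (-(z.1 * a z.2.1), b z.2.2))
          ((continuousOn_fst.mul h1).neg.prodMk h2) fun z hz => ?_)
      exacts [⟨ham hz.2.1, hneg (hscale hz.1 (hbm hz.2.2))⟩,
        ⟨hneg (hscale hz.1 (ham hz.2.1)), hbm hz.2.2⟩])
    (by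
      rintro r hr ⟨x, y⟩ hz h
      obtain ⟨hx, hy⟩ := hz.1
      have := hgi ⟨ham hx, hneg (hscale hr (hbm hy))⟩ ⟨hneg (hscale hr (ham hx)), hbm hy⟩
        (sub_eq_zero.1 h)
      rw [Prod.mk.injEq] at this
      have hr' : 1 + r ≠ 0 := by linarith [hr.1]
      have h1 : a x = 0 := (mul_eq_zero.1 (by linear_combination this.1 :
        (1 + r) * a x = 0)).resolve_left hr'
      have h2 : b y = 0 := (mul_eq_zero.1 (by linear_combination -this.2 :
        (1 + r) * b y = 0)).resolve_left hr'
      exact hbd _ hz ⟨hai hx hs (h1.trans ha0.symm), hbi hy ht (h2.trans hb0.symm)⟩)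
  -- Straightening `a` and `b` to functions odd about `s` and `t` makes the difference odd about the
  -- centre, as `rectChange_odd` requires.
  have e2 := rectChange_homotopy (a := s - δ) (b := s + δ) (c := t - δ) (d := t + δ)
    (H := fun r x y => g (A r x, -B r y) - g (-A r x, B r y)) hle hle' (by
      have h1 : ContinuousOn (fun z : ℝ × ℝ × ℝ => A z.1 z.2.1)
          (Icc 0 1 ×ˢ (Icc (s - δ) (s + δ) ×ˢ Icc (t - δ) (t + δ))) :=
        hAc.comp (f := fun z : ℝ × ℝ × ℝ => (z.1, z.2.1)) (by fun_prop)
          fun z hz => ⟨hz.1, hz.2.1⟩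
      have h2 : ContinuousOn (fun z : ℝ × ℝ × ℝ => B z.1 z.2.2)
          (Icc 0 1 ×ˢ (Icc (s - δ) (s + δ) ×ˢ Icc (t - δ) (t + δ))) :=
        hBc.comp (f := fun z : ℝ × ℝ × ℝ => (z.1, z.2.2)) (by fun_prop)
          fun z hz => ⟨hz.1, hz.2.2⟩
      refine (hg.comp (f := fun z : ℝ × ℝ × ℝ => (A z.1 z.2.1, -B z.1 z.2.2)) (h1.prodMk h2.neg)
        fun z hz => ?_).sub (hg.comp (f := fun z : ℝ × ℝ × ℝ => (-A z.1 z.2.1, B z.1 z.2.2))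
          (h1.neg.prodMk h2) fun z hz => ?_)
      exacts [⟨(hA _ hz.1 _ hz.2.1).1, hneg (hB _ hz.1 _ hz.2.2).1⟩,
        ⟨hneg (hA _ hz.1 _ hz.2.1).1, (hB _ hz.1 _ hz.2.2).1⟩])
    (by
      rintro r hr ⟨x, y⟩ hz h
      obtain ⟨hx, hy⟩ := hz.1
      have := hgi ⟨(hA r hr x hx).1, hneg (hB r hr y hy).1⟩
        ⟨hneg (hA r hr x hx).1, (hB r hr y hy).1⟩ (sub_eq_zero.1 h)
      rw [Prod.mk.injEq] at this
      exact hbd _ hz ⟨(hA r hr x hx).2 (by linarith [this.1]),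
        (hB r hr y hy).2 (by linarith [this.2])⟩)
  have hone : (1 : ℝ) ∈ Icc (0 : ℝ) 1 := ⟨zero_le_one, le_rfl⟩
  obtain ⟨k, hk⟩ := rectChange_odd (F := fun x y => g (A 1 x, -B 1 y) - g (-A 1 x, B 1 y))
    hle hle' (by
      have h1 : ContinuousOn (fun z : ℝ × ℝ => A 1 z.1)
          (Icc (s - δ) (s + δ) ×ˢ Icc (t - δ) (t + δ)) :=
        hAc.comp (f := fun z : ℝ × ℝ => (1, z.1)) (by fun_prop) fun z hz => ⟨hone, hz.1⟩
      have h2 : ContinuousOn (fun z : ℝ × ℝ => B 1 z.2)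
          (Icc (s - δ) (s + δ) ×ˢ Icc (t - δ) (t + δ)) :=
        hBc.comp (f := fun z : ℝ × ℝ => (1, z.2)) (by fun_prop) fun z hz => ⟨hone, hz.2⟩
      refine (hg.comp (f := fun z : ℝ × ℝ => (A 1 z.1, -B 1 z.2)) (h1.prodMk h2.neg)
        fun z hz => ?_).sub (hg.comp (f := fun z : ℝ × ℝ => (-A 1 z.1, B 1 z.2))
          (h1.neg.prodMk h2) fun z hz => ?_)
      exacts [⟨(hA _ hone _ hz.1).1, hneg (hB _ hone _ hz.2).1⟩,
        ⟨hneg (hA _ hone _ hz.1).1, (hB _ hone _ hz.2).1⟩])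
    (by
      rintro ⟨x, y⟩ hz h
      obtain ⟨hx, hy⟩ := hz.1
      have := hgi ⟨(hA 1 hone x hx).1, hneg (hB 1 hone y hy).1⟩
        ⟨hneg (hA 1 hone x hx).1, (hB 1 hone y hy).1⟩ (sub_eq_zero.1 h)
      rw [Prod.mk.injEq] at this
      exact hbd _ hz ⟨(hA 1 hone x hx).2 (by linarith [this.1]),
        (hB 1 hone y hy).2 (by linarith [this.2])⟩)
    (fun x y => by simp only [hA1, hB1, neg_neg, neg_sub])
  refine ⟨k, ?_⟩
  rw [← hk, ← e2]
  simp only [hA0, hB0]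
  simpa using e1

/-- The plane of complex numbers. -/
def toComplex : Plane ≃ₗᵢ[ℝ] ℂ := Complex.orthonormalBasisOneI.repr.symm

/-- Topologically transversal arcs have odd local intersection number. -/
theorem locallyOdd_of_transversal {α β : ℝ → Plane} (hα : Continuous α) (hβ : Continuous β)
    {s t : ℝ} (hst : α s = β t) (hαi : ∃ U ∈ 𝓝 s, InjOn α U) (hβi : ∃ U ∈ 𝓝 t, InjOn β U)
    (h : OpenPartialHomeomorph Plane Plane) (hsrc : α s ∈ h.source) (h0 : h (α s) = 0)
    (hαh : ∀ᶠ x in 𝓝 s, h (α x) 1 = 0) (hβh : ∀ᶠ y in 𝓝 t, h (β y) 0 = 0) :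
    LocallyOdd (fun x y => toComplex (α x) - toComplex (β y)) s t := by
  obtain ⟨U, hU, hUi⟩ := hαi
  obtain ⟨W, hW, hWi⟩ := hβi
  have hmk : Continuous fun z : ℝ × ℝ => (!₂[z.1, z.2] : Plane) := by fun_prop
  obtain ⟨ε, hε, hbox⟩ : ∃ ε > 0, ∀ z ∈ Ioo (-ε) ε ×ˢ Ioo (-ε) ε,
      (!₂[z.1, z.2] : Plane) ∈ h.target := by
    have h1 : ∀ᶠ z : ℝ × ℝ in 𝓝 0, (!₂[z.1, z.2] : Plane) ∈ h.target := by
      refine hmk.continuousAt.eventually_mem (h.open_target.mem_nhds ?_)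
      have : (!₂[(0 : ℝ × ℝ).1, (0 : ℝ × ℝ).2] : Plane) = 0 := by
        ext i; fin_cases i <;> simp
      rw [this, ← h0]
      exact h.map_source hsrc
    obtain ⟨ε, hε, hball⟩ := Metric.eventually_nhds_iff.1 h1
    refine ⟨ε, hε, fun z hz => hball ?_⟩
    rw [dist_zero_right, Prod.norm_def, max_lt_iff, Real.norm_eq_abs, Real.norm_eq_abs, abs_lt,
      abs_lt]
    exact hz
  have good : ∀ {γ : ℝ → Plane} {u : ℝ} (i : Fin 2), Continuous γ → γ u = α s →
      ∀ᶠ x in 𝓝 u, γ x ∈ h.source ∧ h (γ x) i ∈ Ioo (-ε) ε := by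
    intro γ u i hγ hu
    have hc : ContinuousAt (fun x => h (γ x) i) u := by
      have h1 : ContinuousAt h (γ u) := h.continuousAt (hu ▸ hsrc)
      have h2 : ContinuousAt (fun x => h (γ x)) u :=
        ContinuousAt.comp (f := γ) (g := h) h1 hγ.continuousAt
      have h3 : Continuous fun p : Plane => p i := by fun_prop
      exact ContinuousAt.comp (g := fun p : Plane => p i) h3.continuousAt h2
    refine (hγ.continuousAt.eventually_mem (h.open_source.mem_nhds (hu ▸ hsrc))).and
      (hc.eventually_mem (Ioo_mem_nhds ?_ ?_)) <;> simp [hu, h0, hε]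
  have e1 := hαh.and ((good 0 hα rfl).and hU)
  have e2 := hβh.and ((good 1 hβ hst.symm).and hW)
  obtain ⟨δ₁, hδ₁, hs⟩ := Metric.eventually_nhds_iff.1 e1
  obtain ⟨δ₂, hδ₂, ht⟩ := Metric.eventually_nhds_iff.1 e2
  have hev : ∀ᶠ δ in 𝓝[>] (0 : ℝ), δ < δ₁ ∧ δ < δ₂ ∧ 0 < δ :=
    (eventually_nhdsWithin_of_eventually_nhds (Iio_mem_nhds hδ₁)).and
      ((eventually_nhdsWithin_of_eventually_nhds (Iio_mem_nhds hδ₂)).and self_mem_nhdsWithin)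
  refine hev.mono fun δ ⟨h1, h2, hδ⟩ => ?_
  have hs' : ∀ x ∈ Icc (s - δ) (s + δ), _ := fun x hx => @hs x (by
    rw [Real.dist_eq]
    exact (abs_le.2 ⟨by linarith [hx.1], by linarith [hx.2]⟩).trans_lt h1)
  have ht' : ∀ y ∈ Icc (t - δ) (t + δ), _ := fun y hy => @ht y (by
    rw [Real.dist_eq]
    exact (abs_le.2 ⟨by linarith [hy.1], by linarith [hy.2]⟩).trans_lt h2)
  -- In the chart `h` the two arcs lie on the coordinate axes, so each is described by one real
  -- coordinate; local injectivity passes to that coordinate.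
  have ev1 : ∀ x ∈ Icc (s - δ) (s + δ), h (α x) = !₂[h (α x) 0, 0] := fun x hx => by
    ext i; fin_cases i <;> simp [(hs' x hx).1]
  have ev2 : ∀ y ∈ Icc (t - δ) (t + δ), h (β y) = !₂[0, h (β y) 1] := fun y hy => by
    ext i; fin_cases i <;> simp [(ht' y hy).1]
  have hcoord : ∀ {γ : ℝ → Plane} {S : Set ℝ} (i : Fin 2), Continuous γ →
      (∀ x ∈ S, γ x ∈ h.source) → ContinuousOn (fun x => h (γ x) i) S := by
    intro γ S i hγ hS
    have h3 : Continuous fun p : Plane => p i := by fun_prop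
    exact h3.comp_continuousOn (h.continuousOn.comp hγ.continuousOn hS)
  obtain ⟨k, hk⟩ := rectChange_of_axes (g := fun z => toComplex (h.symm !₂[z.1, z.2]))
    (a := fun x => h (α x) 0) (b := fun y => h (β y) 1) (s := s) (t := t) (ε := ε) hδ
    (toComplex.continuous.comp_continuousOn
      (h.continuousOn_symm.comp hmk.continuousOn fun z hz => hbox z hz))
    (fun z hz w hw hzw => by
      have := h.symm.injOn (hbox z hz) (hbox w hw) (toComplex.injective hzw)
      have e0 := congrArg (fun p : Plane => p 0) this
      have e1 := congrArg (fun p : Plane => p 1) this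
      exact Prod.ext (by simpa using e0) (by simpa using e1))
    (hcoord 0 hα fun x hx => (hs' x hx).2.1.1)
    (fun x hx y hy hxy => hUi (hs' x hx).2.2 (hs' y hy).2.2
      (h.injOn (hs' x hx).2.1.1 (hs' y hy).2.1.1 (by
        rw [ev1 x hx, ev1 y hy]; simp only at hxy; rw [hxy])))
    (by simp [h0]) (fun x hx => (hs' x hx).2.1.2)
    (hcoord 1 hβ fun x hx => (ht' x hx).2.1.1)
    (fun x hx y hy hxy => hWi (ht' x hx).2.2 (ht' y hy).2.2
      (h.injOn (ht' x hx).2.1.1 (ht' y hy).2.1.1 (by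
        rw [ev2 x hx, ev2 y hy]; simp only at hxy; rw [hxy])))
    (by simp [← hst, h0]) (fun x hx => (ht' x hx).2.1.2)
  refine ⟨k, ?_⟩
  rw [← hk]
  have f1 : ∀ x ∈ Icc (s - δ) (s + δ), α x = h.symm !₂[h (α x) 0, 0] := fun x hx => by
    rw [← ev1 x hx, h.left_inv (hs' x hx).2.1.1]
  have f2 : ∀ y ∈ Icc (t - δ) (t + δ), β y = h.symm !₂[0, h (β y) 1] := fun y hy => by
    rw [← ev2 y hy, h.left_inv (ht' y hy).2.1.1]
  refine rectChange_congr (by linarith) (by linarith) fun x hx y hy => ?_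
  simp only
  rw [← f1 x hx, ← f2 y hy]

end TransversalCrossing

/-! ### The van Kampen number of $K_{3,3}$. -/

section VanKampen

/-- Every pair of disjoint edges of `K_{3,3}`, exactly once. -/
def disjointPairs : Finset ((Fin 3 × Fin 3) × (Fin 3 × Fin 3)) :=
  Finset.univ.filter fun e => e.1.1 < e.2.1 ∧ e.1.2 ≠ e.2.2

theorem exists_int_of_exp_eq {x y : ℂ} (h : exp x = exp y) :
    ∃ n : ℤ, x = y + n * (2 * π * I) := Complex.exp_eq_exp_iff_exists_int.1 h

/-- Modulo 2, every `x i j k` with $k\ne i$ and every `y i j l` with $l\ne j$ occurs twice in the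
sum. The constants contribute one for each of the nine choices $i<k$, $j<l$. -/
theorem sum_disjointPairs_odd {x y : Fin 3 → Fin 3 → Fin 3 → ℤ}
    {w : (Fin 3 × Fin 3) × (Fin 3 × Fin 3) → ℤ}
    (hw : ∀ i j k l, i < k → j ≠ l → w ((i, j), (k, l)) =
      x i j k + y k l j - y i j l - x k l i + if j < l then 1 else 0) :
    Odd (∑ e ∈ disjointPairs, w e) := by
  have h : ∑ e ∈ disjointPairs, w e = ∑ e : (Fin 3 × Fin 3) × (Fin 3 × Fin 3),
      if e.1.1 < e.2.1 ∧ e.1.2 ≠ e.2.2 then x e.1.1 e.1.2 e.2.1 + y e.2.1 e.2.2 e.1.2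
        - y e.1.1 e.1.2 e.2.2 - x e.2.1 e.2.2 e.1.1 + if e.1.2 < e.2.2 then 1 else 0 else 0 := by
    rw [disjointPairs, Finset.sum_filter]
    exact Finset.sum_congr rfl fun e _ => if_ctx_congr Iff.rfl (fun h => hw _ _ _ _ h.1 h.2)
      fun _ => rfl
  rw [h]
  simp only [Fintype.sum_prod_type, Fin.sum_univ_three, Int.odd_iff]
  simp only [Fin.isValue, Fin.reduceLT, Fin.reduceEq, ne_eq, not_true_eq_false, not_false_eq_true,
    and_true, and_false, if_true, if_false]
  omega

/-- The van Kampen number of `K_{3,3}` is odd: for nine arcs joining the points `p i` to the points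
`q j`, whose interiors avoid these points, the pairs of disjoint edges have odd intersection
number in total. -/
theorem sum_windings_odd {p q : Fin 3 → ℂ} {A : Fin 3 → Fin 3 → ℝ → ℂ}
    (hA : ∀ i j, Continuous (A i j)) (hA0 : ∀ i j, A i j 0 = p i) (hA1 : ∀ i j, A i j 1 = q j)
    (hp : ∀ i j k, k ≠ i → ∀ s ∈ Icc (0 : ℝ) 1, A i j s ≠ p k)
    (hq : ∀ i j l, l ≠ j → ∀ s ∈ Icc (0 : ℝ) 1, A i j s ≠ q l)
    {w : (Fin 3 × Fin 3) × (Fin 3 × Fin 3) → ℤ}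
    (hw : ∀ e ∈ disjointPairs,
      rectChange (fun s t => A e.1.1 e.1.2 s - A e.2.1 e.2.2 t) 0 1 0 1 = w e * (2 * π * I)) :
    Odd (∑ e ∈ disjointPairs, w e) := by
  have m0 : (0 : ℝ) ∈ Icc (0 : ℝ) 1 := ⟨le_rfl, zero_le_one⟩
  have m1 : (1 : ℝ) ∈ Icc (0 : ℝ) 1 := ⟨zero_le_one, le_rfl⟩
  have hpp : ∀ {i k}, i ≠ k → p i - p k ≠ 0 := fun {i k} h =>
    sub_ne_zero.2 (hA0 i 0 ▸ hp i 0 k h.symm 0 m0)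
  have hqq : ∀ {j l}, j ≠ l → q j - q l ≠ 0 := fun {j l} h =>
    sub_ne_zero.2 (hA1 0 j ▸ hq 0 j l h.symm 1 m1)
  have hpq : ∀ k j, p k - q j ≠ 0 := fun k j => by
    obtain ⟨i, hi⟩ := exists_ne k
    exact sub_ne_zero.2 (hA1 i j ▸ (hp i j k hi.symm 1 m1).symm)
  have chA : ∀ i j z, (∀ s ∈ Icc (0 : ℝ) 1, A i j s ≠ z) →
      exp (logChange (fun s => A i j s - z) 0 1) = (q j - z) / (p i - z) := fun i j z hz => by
    rw [exp_logChange (γ := fun s => A i j s - z) zero_le_one ((hA i j).sub continuous_const).continuousOn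
      fun s hs => sub_ne_zero.2 (hz s hs), hA0, hA1]
  -- One logarithm is fixed per pair of vertices, always of the difference taken in the same
  -- direction. The term $\pi i$ corrects the sign when the actual quotient has the opposite one.
  have exx : ∀ i j k, ∃ n : ℤ, k ≠ i → logChange (fun s => A i j s - p k) 0 1 =
      Complex.log (p k - q j) - Complex.log (p (min i k) - p (max i k))
        + (if i < k then π * I else 0) + n * (2 * π * I) := by
    intro i j k
    by_cases hik : k = i
    · exact ⟨0, fun h => (h hik).elim⟩
    · refine (exists_int_of_exp_eq ?_).imp fun n hn _ => hn
      rw [chA i j _ (hp i j k hik), Complex.exp_add, Complex.exp_sub, Complex.exp_log (hpq k j)]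
      rcases lt_or_gt_of_ne hik with h | h
      · rw [min_eq_right h.le, max_eq_left h.le, Complex.exp_log (hpp h.ne), if_neg h.not_gt,
          Complex.exp_zero, mul_one, ← neg_sub, ← neg_sub (p k) (p i), neg_div_neg_eq]
      · rw [min_eq_left h.le, max_eq_right h.le, Complex.exp_log (hpp h.ne), if_pos h,
          Complex.exp_pi_mul_I, mul_neg_one, ← neg_div, neg_sub]
  have exy : ∀ i j l, ∃ n : ℤ, l ≠ j → logChange (fun s => A i j s - q l) 0 1 =
      Complex.log (q (min j l) - q (max j l)) - Complex.log (p i - q l)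
        + (if l < j then π * I else 0) + n * (2 * π * I) := by
    intro i j l
    by_cases hjl : l = j
    · exact ⟨0, fun h => (h hjl).elim⟩
    · refine (exists_int_of_exp_eq ?_).imp fun n hn _ => hn
      rw [chA i j _ (hq i j l hjl), Complex.exp_add, Complex.exp_sub, Complex.exp_log (hpq i l)]
      rcases lt_or_gt_of_ne hjl with h | h
      · rw [min_eq_right h.le, max_eq_left h.le, Complex.exp_log (hqq h.ne), if_pos h,
          Complex.exp_pi_mul_I, mul_neg_one, ← neg_div, neg_sub]
      · rw [min_eq_left h.le, max_eq_right h.le, Complex.exp_log (hqq h.ne), if_neg h.not_gt,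
          Complex.exp_zero, mul_one]
  choose x hx using exx
  choose y hy using exy
  refine sum_disjointPairs_odd (x := x) (y := y) fun i j k l hik hjl => ?_
  have h := hw ((i, j), (k, l)) (by simp [disjointPairs, hik, hjl])
  have swap : ∀ i j z, (∀ s ∈ Icc (0 : ℝ) 1, A i j s ≠ z) →
      logChange (fun s => z - A i j s) 0 1 = logChange (fun s => A i j s - z) 0 1 :=
    fun i j z hz => by
      rw [← logChange_neg (γ := fun s => A i j s - z) zero_le_one ((hA i j).sub continuous_const).continuousOn
        fun s hs => sub_ne_zero.2 (hz s hs)]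
      simp only [neg_sub]
  simp only [rectChange, hA0, hA1] at h
  rw [swap k l _ (hq k l j hjl), swap k l _ (hp k l i hik.ne), hx i j k hik.ne', hy k l j hjl,
    hy i j l hjl.symm, hx k l i hik.ne, min_comm k i, max_comm k i, min_comm l j, max_comm l j,
    if_pos hik, if_neg hik.not_gt] at h
  have h2 : (2 * π * I : ℂ) ≠ 0 := Complex.two_pi_I_ne_zero
  -- Round the square the fixed logarithms cancel. The corrections leave $2\pi i$ if $j<l$ and $0$
  -- if $l<j$.
  have key : ((w ((i, j), (k, l)) : ℤ) : ℂ) = ((x i j k + y k l j - y i j l - x k l i +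
      if j < l then 1 else 0 : ℤ) : ℂ) := by
    refine mul_right_cancel₀ h2 ?_
    rw [← h]
    rcases lt_or_gt_of_ne hjl with hl | hl
    · rw [if_pos hl, if_neg hl.not_gt, if_pos hl]
      push_cast
      ring
    · rw [if_neg hl.not_gt, if_pos hl, if_neg hl.not_gt]
      push_cast
      ring
  exact_mod_cast key

end VanKampen

/-! ### The 4-cycles and 6-cycles of $K_{3,3}$ as edge sets. -/

section Cycles

local notation "K₃₃" => completeBipartiteGraph (Fin 3) (Fin 3)

/-- The subgraph of `K_{3,3}` formed by a set of edges. -/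
def subgraphOfEdges (S : Finset (Fin 3 × Fin 3)) : (K₃₃).Subgraph where
  verts := {v | ∃ e ∈ S, v = Sum.inl e.1 ∨ v = Sum.inr e.2}
  Adj u v := ∃ e ∈ S, (u = Sum.inl e.1 ∧ v = Sum.inr e.2) ∨ (u = Sum.inr e.2 ∧ v = Sum.inl e.1)
  adj_sub := by
    rintro u v ⟨e, -, ⟨rfl, rfl⟩ | ⟨rfl, rfl⟩⟩ <;> simp
  edge_vert := by
    rintro u v ⟨e, he, ⟨rfl, rfl⟩ | ⟨rfl, rfl⟩⟩
    exacts [⟨e, he, Or.inl rfl⟩, ⟨e, he, Or.inr rfl⟩]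
  symm := ⟨by
    rintro u v ⟨e, he, h⟩
    exact ⟨e, he, h.symm.imp And.symm And.symm⟩⟩

theorem subgraphOfEdges_adj {S : Finset (Fin 3 × Fin 3)} {i j : Fin 3} :
    (subgraphOfEdges S).Adj (Sum.inl i) (Sum.inr j) ↔ (i, j) ∈ S := by
  simp only [subgraphOfEdges, Sum.inl.injEq, Sum.inr.injEq, reduceCtorEq, false_and, or_false]
  constructor
  · rintro ⟨e, he, rfl, rfl⟩
    exact he
  · exact fun h => ⟨_, h, rfl, rfl⟩

theorem subgraphOfEdges_injective : Function.Injective subgraphOfEdges := fun S T h => by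
  ext ⟨i, j⟩
  rw [← subgraphOfEdges_adj, h, subgraphOfEdges_adj]

/-- The edge sets of the 4-cycles of `K_{3,3}`. -/
def fourCycles : Finset (Finset (Fin 3 × Fin 3)) :=
  Finset.univ.image fun v : Fin 3 × Fin 3 => Finset.univ.filter fun e => e.1 ≠ v.1 ∧ e.2 ≠ v.2

/-- The edge sets of the 6-cycles of `K_{3,3}`: the complements of perfect matchings. -/
def sixCycles : Finset (Finset (Fin 3 × Fin 3)) :=
  Finset.univ.image fun σ : Equiv.Perm (Fin 3) => Finset.univ.filter fun e => e.2 ≠ σ e.1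

/-- The count is 4 for equal edges, 2 for distinct edges with a common vertex, and 1 for disjoint
edges. -/
theorem odd_card_fourCycles : ∀ e e' : Fin 3 × Fin 3,
    (Odd (fourCycles.filter fun S => e ∈ S ∧ e' ∈ S).card ↔ e.1 ≠ e'.1 ∧ e.2 ≠ e'.2) := by
  decide +kernel

/-- The count is 4 for equal edges, 2 for distinct edges with a common vertex, and $6-2-2+1=3$ for
disjoint edges. -/
theorem odd_card_sixCycles : ∀ e e' : Fin 3 × Fin 3,
    (Odd (sixCycles.filter fun S => e ∈ S ∧ e' ∈ S).card ↔ e.1 ≠ e'.1 ∧ e.2 ≠ e'.2) := by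
  decide +kernel

theorem edgeSet_mem_fourCycles : ∀ i j k l : Fin 3, i ≠ k → j ≠ l →
    ({(i, j), (k, j), (k, l), (i, l)} : Finset (Fin 3 × Fin 3)) ∈ fourCycles := by
  decide +kernel

theorem edgeSet_mem_sixCycles : ∀ i j k l m n : Fin 3, i ≠ k → i ≠ m → k ≠ m → j ≠ l → j ≠ n → l ≠ n →
    ({(i, j), (k, j), (k, l), (m, l), (m, n), (i, n)} : Finset (Fin 3 × Fin 3)) ∈ sixCycles := by
  decide +kernel

theorem exists_eq_of_mem_fourCycles : ∀ S ∈ fourCycles, ∃ i j k l : Fin 3, i ≠ k ∧ j ≠ l ∧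
    S = {(i, j), (k, j), (k, l), (i, l)} := by
  decide +kernel

theorem exists_eq_of_mem_sixCycles : ∀ S ∈ sixCycles, ∃ i j k l m n : Fin 3, i ≠ k ∧ i ≠ m ∧ k ≠ m ∧ j ≠ l ∧
    j ≠ n ∧ l ≠ n ∧ S = {(i, j), (k, j), (k, l), (m, l), (m, n), (i, n)} := by
  decide +kernel

theorem subgraph_eq_subgraphOfEdges {H : (K₃₃).Subgraph} {S : Finset (Fin 3 × Fin 3)}
    (hv : ∀ v ∈ H.verts, ∃ u, H.Adj v u)
    (hS : ∀ i j, H.Adj (Sum.inl i) (Sum.inr j) ↔ (i, j) ∈ S) : H = subgraphOfEdges S := by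
  have hadj : ∀ u v, H.Adj u v ↔ (subgraphOfEdges S).Adj u v := by
    rintro (i | j) (k | l)
    · exact iff_of_false (fun h => by simpa using h.adj_sub) fun h => by simpa using h.adj_sub
    · rw [hS, subgraphOfEdges_adj]
    · rw [H.adj_comm, (subgraphOfEdges S).adj_comm, hS, subgraphOfEdges_adj]
    · exact iff_of_false (fun h => by simpa using h.adj_sub) fun h => by simpa using h.adj_sub
  ext u v
  · constructor
    · intro h
      obtain ⟨v, hv⟩ := hv u h
      exact ((hadj _ _).1 hv).fst_mem
    · rintro ⟨e, he, rfl | rfl⟩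
      · exact ((hS _ _).2 he).fst_mem
      · exact ((hS _ _).2 he).snd_mem
  · exact hadj u v

theorem toSubgraph_eq_subgraphOfEdges {v : Fin 3 ⊕ Fin 3} {w : (K₃₃).Walk v v} (hw : w.IsCycle)
    {S : Finset (Fin 3 × Fin 3)}
    (hS : ∀ i j, s(Sum.inl i, Sum.inr j) ∈ w.edges ↔ (i, j) ∈ S) :
    w.toSubgraph = subgraphOfEdges S := by
  refine subgraph_eq_subgraphOfEdges (fun u hu => ?_) fun i j => ?_
  · have := hw.ncard_neighborSet_toSubgraph_eq_two (by simpa using hu)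
    obtain ⟨x, hx⟩ := Set.nonempty_of_ncard_ne_zero (s := w.toSubgraph.neighborSet u) (by omega)
    exact ⟨x, hx⟩
  · rw [← hS, ← SimpleGraph.Subgraph.mem_edgeSet, SimpleGraph.Walk.mem_edges_toSubgraph]

/-- The subgraphs of `K_{3,3}` without isolated vertices, parametrized by their edge sets. -/
def edgeSetEmbedding : Finset (Fin 3 × Fin 3) ↪ (K₃₃).Subgraph :=
  ⟨subgraphOfEdges, subgraphOfEdges_injective⟩

theorem cyclesOfLength_four : cyclesOfLength K₃₃ 4 = fourCycles.map edgeSetEmbedding := by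
  ext H
  simp only [cyclesOfLength, Set.Finite.mem_toFinset, mem_ofPred_eq, Finset.mem_map]
  constructor
  · rintro ⟨v, w, hw, hl, rfl⟩
    obtain ⟨S, hS, h⟩ : ∃ S ∈ fourCycles,
        ∀ i j, s(Sum.inl i, Sum.inr j) ∈ w.edges ↔ (i, j) ∈ S := by
      have hn := hw.support_nodup
      -- Bipartiteness leaves only the alternating closed walks, starting on either side; in the
      -- second case the edges are listed from another starting point.
      rcases w with _ | ⟨h1, _ | ⟨h2, _ | ⟨h3, _ | ⟨h4, _ | ⟨h5, w⟩⟩⟩⟩⟩ <;> simp at hl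
      rename_i a b c
      rcases v with v | v <;> rcases a with a | a <;> simp at h1 <;> rcases b with b | b <;>
        simp at h2 <;> rcases c with c | c <;> simp at h3 <;> simp at hn
      · refine ⟨_, edgeSet_mem_fourCycles v a b c (by tauto) (by tauto), fun i j => ?_⟩
        simp
      · refine ⟨_, edgeSet_mem_fourCycles a v c b (by tauto) (by tauto), fun i j => ?_⟩
        simp
        grind
    exact ⟨S, hS, (toSubgraph_eq_subgraphOfEdges hw h).symm⟩
  · rintro ⟨S, hS, rfl⟩
    obtain ⟨i, j, k, l, hik, hjl, rfl⟩ := exists_eq_of_mem_fourCycles S hS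
    let w : (K₃₃).Walk (Sum.inl i) (Sum.inl i) := .cons (v := Sum.inr j) (by simp)
      (.cons (v := Sum.inl k) (by simp) (.cons (v := Sum.inr l) (by simp)
        (.cons (by simp) .nil)))
    have hw : w.IsCycle := by
      simp [w, SimpleGraph.Walk.isCycle_def, SimpleGraph.Walk.isTrail_def, hik,
        hik.symm, hjl]
    refine ⟨_, w, hw, rfl, toSubgraph_eq_subgraphOfEdges hw fun x y => ?_⟩
    simp [w]

theorem cyclesOfLength_six : cyclesOfLength K₃₃ 6 = sixCycles.map edgeSetEmbedding := by
  ext H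
  simp only [cyclesOfLength, Set.Finite.mem_toFinset, mem_ofPred_eq, Finset.mem_map]
  constructor
  · rintro ⟨v, w, hw, hl, rfl⟩
    obtain ⟨S, hS, h⟩ : ∃ S ∈ sixCycles,
        ∀ i j, s(Sum.inl i, Sum.inr j) ∈ w.edges ↔ (i, j) ∈ S := by
      have hn := hw.support_nodup
      rcases w with _ | ⟨h1, _ | ⟨h2, _ | ⟨h3, _ | ⟨h4, _ | ⟨h5, _ | ⟨h6, _ | ⟨h7, w⟩⟩⟩⟩⟩⟩⟩ <;>
        simp at hl
      rename_i a b c d e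
      rcases v with v | v <;> rcases a with a | a <;> simp at h1 <;> rcases b with b | b <;>
        simp at h2 <;> rcases c with c | c <;> simp at h3 <;> rcases d with d | d <;>
        simp at h4 <;> rcases e with e | e <;> simp at h5 <;> simp at hn
      · refine ⟨_, edgeSet_mem_sixCycles v a b c d e ?_ ?_ ?_ ?_ ?_ ?_, fun i j => ?_⟩
        iterate 6 tauto
        simp
      · refine ⟨_, edgeSet_mem_sixCycles a b c d e v ?_ ?_ ?_ ?_ ?_ ?_, fun i j => ?_⟩
        iterate 6 tauto
        simp
        grind
    exact ⟨S, hS, (toSubgraph_eq_subgraphOfEdges hw h).symm⟩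
  · rintro ⟨S, hS, rfl⟩
    obtain ⟨i, j, k, l, m, n, hik, him, hkm, hjl, hjn, hln, rfl⟩ := exists_eq_of_mem_sixCycles S hS
    let w : (K₃₃).Walk (Sum.inl i) (Sum.inl i) := .cons (v := Sum.inr j) (by simp)
      (.cons (v := Sum.inl k) (by simp) (.cons (v := Sum.inr l) (by simp)
        (.cons (v := Sum.inl m) (by simp) (.cons (v := Sum.inr n) (by simp)
          (.cons (by simp) .nil)))))
    have hw : w.IsCycle := by
      simp [w, SimpleGraph.Walk.isCycle_def, SimpleGraph.Walk.isTrail_def, hik, hik.symm,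
        him, him.symm, hkm, hjl, hjn, hln]
    refine ⟨_, w, hw, rfl, toSubgraph_eq_subgraphOfEdges hw fun x y => ?_⟩
    simp [w]

end Cycles

/-! ### Parametrization of the edges. -/

section EdgeArcs

local notation "K₃₃" => completeBipartiteGraph (Fin 3) (Fin 3)

/-- The point of the edge `e` of `K_{3,3}` with parameter `s`. -/
def edgePoint (e : Fin 3 × Fin 3) (s : ℝ) : Fin 3 ⊕ Fin 3 → ℝ :=
  (1 - s) • vertexPoint (Sum.inl e.1) + s • vertexPoint (Sum.inr e.2)

@[simp]
theorem edgePoint_inl (e : Fin 3 × Fin 3) (s : ℝ) (k : Fin 3) :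
    edgePoint e s (Sum.inl k) = if k = e.1 then 1 - s else 0 := by
  simp [edgePoint, vertexPoint, Pi.single_apply]

@[simp]
theorem edgePoint_inr (e : Fin 3 × Fin 3) (s : ℝ) (l : Fin 3) :
    edgePoint e s (Sum.inr l) = if l = e.2 then s else 0 := by
  simp [edgePoint, vertexPoint, Pi.single_apply]

theorem edgePoint_zero (e : Fin 3 × Fin 3) : edgePoint e 0 = vertexPoint (Sum.inl e.1) := by
  simp [edgePoint]

theorem edgePoint_one (e : Fin 3 × Fin 3) : edgePoint e 1 = vertexPoint (Sum.inr e.2) := by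
  simp [edgePoint]

theorem mem_segment_iff_edgePoint {e : Fin 3 × Fin 3} {x : Fin 3 ⊕ Fin 3 → ℝ} :
    x ∈ segment ℝ (vertexPoint (Sum.inl e.1)) (vertexPoint (Sum.inr e.2)) ↔
      ∃ s ∈ Icc (0 : ℝ) 1, edgePoint e s = x := by
  rw [segment_eq_image]
  rfl

theorem edgePoint_ne_vertexPoint {e : Fin 3 × Fin 3} {s : ℝ} (hs : s ∈ Ioo (0 : ℝ) 1)
    (v : Fin 3 ⊕ Fin 3) : edgePoint e s ≠ vertexPoint v := by
  intro h
  have h1 := congrFun h (Sum.inl e.1)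
  have h2 := congrFun h (Sum.inr e.2)
  rcases v with i | j <;> simp [vertexPoint, Pi.single_apply] at h1 h2 <;>
    linarith [hs.1, hs.2]

/-- A coincidence of points of edges determines the parameter, and the edge unless the point is
a vertex. -/
theorem edgePoint_eq {e e' : Fin 3 × Fin 3} {s t : ℝ} (h : edgePoint e s = edgePoint e' t) :
    s = t ∧ (s = 1 ∨ e.1 = e'.1) ∧ (s = 0 ∨ e.2 = e'.2) := by
  have h1 := congrFun h (Sum.inl e.1)
  have h2 := congrFun h (Sum.inr e.2)
  -- If the left endpoints differ, then $s=1$, and this coordinate yields $t=1$.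
  have h3 := congrFun h (Sum.inl e'.1)
  simp only [edgePoint_inl, edgePoint_inr] at h1 h2 h3
  grind

theorem edgePoint_injOn {e e' : Fin 3 × Fin 3} {s t : ℝ} (hs : s ∈ Ioo (0 : ℝ) 1)
    (h : edgePoint e s = edgePoint e' t) : e = e' ∧ s = t := by
  obtain ⟨h1, h2, h3⟩ := edgePoint_eq h
  exact ⟨Prod.ext (h2.resolve_left hs.2.ne) (h3.resolve_left hs.1.ne'), h1⟩

theorem mem_subgraphSpace {H : (K₃₃).Subgraph} {x : Fin 3 ⊕ Fin 3 → ℝ} :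
    x ∈ subgraphSpace H ↔ (∃ v ∈ H.verts, x = vertexPoint v) ∨
      ∃ e : Fin 3 × Fin 3, H.Adj (Sum.inl e.1) (Sum.inr e.2) ∧
        ∃ s ∈ Icc (0 : ℝ) 1, edgePoint e s = x := by
  refine or_congr ⟨fun ⟨v, hv, h⟩ => ⟨v, hv, h.symm⟩, fun ⟨v, hv, h⟩ => ⟨v, hv, h.symm⟩⟩ ?_
  constructor
  · rintro ⟨i | j, k | l, h, hx⟩
    · simpa using h.adj_sub
    · exact ⟨(i, l), h, mem_segment_iff_edgePoint.1 hx⟩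
    · exact ⟨(k, j), h.symm, mem_segment_iff_edgePoint.1 (by rwa [segment_symm])⟩
    · simpa using h.adj_sub
  · rintro ⟨e, h, hx⟩
    exact ⟨_, _, h, mem_segment_iff_edgePoint.2 hx⟩

theorem edgePoint_mem_subgraphSpace {S : Finset (Fin 3 × Fin 3)} {e : Fin 3 × Fin 3} {s : ℝ}
    (hs : s ∈ Ioo (0 : ℝ) 1) : edgePoint e s ∈ subgraphSpace (subgraphOfEdges S) ↔ e ∈ S := by
  rw [mem_subgraphSpace]
  constructor
  · rintro (⟨v, -, h⟩ | ⟨d, hd, t, -, h⟩)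
    · exact (edgePoint_ne_vertexPoint hs v h).elim
    · rw [(edgePoint_injOn hs h.symm).1]
      exact subgraphOfEdges_adj.1 hd
  · exact fun he => Or.inr ⟨e, subgraphOfEdges_adj.2 he, s, Ioo_subset_Icc_self hs, rfl⟩

theorem edgePoint_mem_graphSpace (e : Fin 3 × Fin 3) {s : ℝ} (hs : s ∈ Icc (0 : ℝ) 1) :
    edgePoint e s ∈ graphSpace K₃₃ :=
  mem_subgraphSpace.2 (Or.inr ⟨e, by simp, s, hs, rfl⟩)

/-- The edge `e` of `K_{3,3}` as an arc in its space, constant outside of `[0, 1]`. -/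
def edgeArc (e : Fin 3 × Fin 3) (s : ℝ) : graphSpace K₃₃ :=
  ⟨edgePoint e (clamp 0 1 s), edgePoint_mem_graphSpace e (clamp_mem zero_le_one s)⟩

theorem continuous_edgeArc (e : Fin 3 × Fin 3) : Continuous (edgeArc e) := by
  have h := continuous_clamp 0 1
  unfold edgeArc edgePoint
  fun_prop

theorem edgeArc_val {e : Fin 3 × Fin 3} {s : ℝ} (hs : s ∈ Icc (0 : ℝ) 1) :
    (edgeArc e s).1 = edgePoint e s :=
  congrArg (edgePoint e) (clamp_of_mem hs)

theorem edgeArc_eq {e e' : Fin 3 × Fin 3} {s t : ℝ} (hs : s ∈ Icc (0 : ℝ) 1)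
    (ht : t ∈ Icc (0 : ℝ) 1) (h : edgeArc e s = edgeArc e' t) :
    s = t ∧ (s = 1 ∨ e.1 = e'.1) ∧ (s = 0 ∨ e.2 = e'.2) :=
  edgePoint_eq (by rw [← edgeArc_val hs, h, edgeArc_val ht])

theorem eq_edgeArc_of_ne_vertexPoint (x : graphSpace K₃₃) (hx : ∀ v, x.1 ≠ vertexPoint v) :
    ∃ e, ∃ s ∈ Ioo (0 : ℝ) 1, x = edgeArc e s := by
  obtain ⟨v, -, h⟩ | ⟨e, -, s, hs, h⟩ := mem_subgraphSpace.1 x.2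
  · exact (hx v h).elim
  · refine ⟨e, s, ⟨lt_of_le_of_ne hs.1 ?_, lt_of_le_of_ne hs.2 ?_⟩,
      Subtype.ext (h.symm.trans (edgeArc_val hs).symm)⟩
    · rintro rfl
      exact hx _ (h.symm.trans (edgePoint_zero e))
    · rintro rfl
      exact hx _ (h.symm.trans (edgePoint_one e))

end EdgeArcs

/-! ### Double points as crossings of edges, and their parity. -/

section Crossings

local notation "K₃₃" => completeBipartiteGraph (Fin 3) (Fin 3)

variable {f : graphSpace K₃₃ → Plane}

/-- The point `p` is a crossing of the edges `e` and `e'`. -/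
def IsCrossing (f : graphSpace K₃₃ → Plane) (p : Plane) (e e' : Fin 3 × Fin 3) : Prop :=
  ∃ s ∈ Ioo (0 : ℝ) 1, ∃ t ∈ Ioo (0 : ℝ) 1, edgeArc e s ≠ edgeArc e' t ∧
    f (edgeArc e s) = p ∧ f (edgeArc e' t) = p

theorem IsCrossing.symm {p : Plane} {e e' : Fin 3 × Fin 3} (h : IsCrossing f p e e') :
    IsCrossing f p e' e := by
  obtain ⟨s, hs, t, ht, hne, h1, h2⟩ := h
  exact ⟨t, ht, s, hs, hne.symm, h2, h1⟩

theorem IsPlaneGenericImmersion.eq_or_eq (hf : IsPlaneGenericImmersion f) {x y z : graphSpace K₃₃}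
    (hxy : x ≠ y) (h : f x = f y) (hz : f z = f x) : z = x ∨ z = y := by
  by_contra! hne
  have h3 : ({z, x, y} : Set (graphSpace K₃₃)).encard = 3 :=
    Set.encard_eq_three.2 ⟨z, x, y, hne.1, hne.2, hxy, rfl⟩
  have h2 := (Set.encard_le_encard (s := {z, x, y}) (t := f ⁻¹' {f x}) (by
    rintro w (rfl | rfl | rfl)
    exacts [hz, rfl, h.symm])).trans (hf.double (f x))
  rw [h3] at h2
  exact absurd h2 (by decide)

theorem crossings_mono (f : graphSpace K₃₃ → Plane) (H : (K₃₃).Subgraph) :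
    crossings f H ⊆ crossings f ⊤ := by
  rintro p ⟨x, y, -, -, h⟩
  exact ⟨x, y, x.2, y.2, h⟩

theorem IsPlaneGenericImmersion.exists_isCrossing (hf : IsPlaneGenericImmersion f) {p : Plane}
    (hp : p ∈ crossings f ⊤) : ∃ e e', IsCrossing f p e e' := by
  obtain ⟨x, y, -, -, hne, hx, hy⟩ := hp
  obtain ⟨e, s, hs, rfl⟩ := eq_edgeArc_of_ne_vertexPoint x (hf.not_vertex x y hne (hx.trans hy.symm))
  obtain ⟨e', t, ht, rfl⟩ :=
    eq_edgeArc_of_ne_vertexPoint y (hf.not_vertex y _ hne.symm (hy.trans hx.symm))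
  exact ⟨e, e', s, hs, t, ht, hne, hx, hy⟩

theorem IsCrossing.mem_crossings {p : Plane} {e e' : Fin 3 × Fin 3} (h : IsCrossing f p e e') :
    p ∈ crossings f ⊤ := by
  obtain ⟨s, -, t, -, hne, h1, h2⟩ := h
  exact ⟨_, _, (edgeArc e s).2, (edgeArc e' t).2, hne, h1, h2⟩

/-- The fibre over a double point has exactly two points, so the crossing survives in a subgraph
only if both branches do. The case `e = e'` of a self-crossing is included. -/
theorem IsPlaneGenericImmersion.mem_crossings_iff (hf : IsPlaneGenericImmersion f) {p : Plane}
    {e e' : Fin 3 × Fin 3} (h : IsCrossing f p e e') (S : Finset (Fin 3 × Fin 3)) :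
    p ∈ crossings f (subgraphOfEdges S) ↔ e ∈ S ∧ e' ∈ S := by
  obtain ⟨s, hs, t, ht, hne, rfl, h2⟩ := h
  have hs' := edgePoint_mem_subgraphSpace (S := S) (e := e) hs
  have ht' := edgePoint_mem_subgraphSpace (S := S) (e := e') ht
  rw [← edgeArc_val (Ioo_subset_Icc_self hs)] at hs'
  rw [← edgeArc_val (Ioo_subset_Icc_self ht)] at ht'
  rw [← hs', ← ht']
  constructor
  · rintro ⟨x, y, hx, hy, hxy, h3, h4⟩
    rcases hf.eq_or_eq hne h2.symm h3 with rfl | rfl <;>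
      rcases hf.eq_or_eq hne h2.symm h4 with rfl | rfl
    exacts [(hxy rfl).elim, ⟨hx, hy⟩, ⟨hy, hx⟩, (hxy rfl).elim]
  · rintro ⟨hx, hy⟩
    exact ⟨_, _, hx, hy, hne, rfl, h2⟩

theorem IsPlaneGenericImmersion.edges_unique (hf : IsPlaneGenericImmersion f) {p : Plane}
    {e e' d d' : Fin 3 × Fin 3} (h : IsCrossing f p e e') (h' : IsCrossing f p d d') :
    d = e ∧ d' = e' ∨ d = e' ∧ d' = e := by
  obtain ⟨s, hs, t, ht, hne, rfl, h2⟩ := h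
  obtain ⟨s', hs', t', ht', hne', h3, h4⟩ := h'
  have inj : ∀ {a b : Fin 3 × Fin 3} {u v : ℝ}, u ∈ Ioo (0 : ℝ) 1 → v ∈ Ioo (0 : ℝ) 1 →
      edgeArc a u = edgeArc b v → a = b := fun hu hv hab =>
    (edgePoint_injOn hu (by rw [← edgeArc_val (Ioo_subset_Icc_self hu), hab,
      edgeArc_val (Ioo_subset_Icc_self hv)])).1
  rcases hf.eq_or_eq hne h2.symm h3 with h5 | h5 <;>
    rcases hf.eq_or_eq hne h2.symm h4 with h6 | h6
  · exact (hne' (h5.trans h6.symm)).elim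
  · exact Or.inl ⟨inj hs' hs h5, inj ht' ht h6⟩
  · exact Or.inr ⟨inj hs' ht h5, inj ht' hs h6⟩
  · exact (hne' (h5.trans h6.symm)).elim

/-- A common point would have parameter both 0 and 1. -/
theorem edgeArc_ne_of_disjoint {e e' : Fin 3 × Fin 3} (h1 : e.1 ≠ e'.1) (h2 : e.2 ≠ e'.2)
    {s t : ℝ} (hs : s ∈ Icc (0 : ℝ) 1) (ht : t ∈ Icc (0 : ℝ) 1) : edgeArc e s ≠ edgeArc e' t := by
  intro h
  obtain ⟨-, h3, h4⟩ := edgeArc_eq hs ht h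
  exact zero_ne_one ((h4.resolve_right h2).symm.trans (h3.resolve_right h1))

theorem IsPlaneGenericImmersion.mem_Ioo (hf : IsPlaneGenericImmersion f) {e : Fin 3 × Fin 3}
    {s : ℝ} (hs : s ∈ Icc (0 : ℝ) 1) {y : graphSpace K₃₃} (hne : edgeArc e s ≠ y)
    (h : f (edgeArc e s) = f y) : s ∈ Ioo (0 : ℝ) 1 := by
  have hv := hf.not_vertex _ _ hne h
  rw [edgeArc_val hs] at hv
  refine ⟨lt_of_le_of_ne hs.1 ?_, lt_of_le_of_ne hs.2 ?_⟩
  · rintro rfl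
    exact hv _ (edgePoint_zero e)
  · rintro rfl
    exact hv _ (edgePoint_one e)

/-- The parameters of the crossings of the edges `e` and `e'`. -/
def crossingParameters (f : graphSpace K₃₃ → Plane) (e e' : Fin 3 × Fin 3) : Set (ℝ × ℝ) :=
  {z | z ∈ Icc (0 : ℝ) 1 ×ˢ Icc (0 : ℝ) 1 ∧ f (edgeArc e z.1) = f (edgeArc e' z.2)}

/-- Each edge carries only one of the two preimages of a crossing. This makes zeros correspond to
crossings and also separates their first coordinates, as `rectChange_eq_card` needs. -/
theorem IsPlaneGenericImmersion.injOn_crossingParameters (hf : IsPlaneGenericImmersion f)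
    {e e' : Fin 3 × Fin 3} (h1 : e.1 ≠ e'.1) (h2 : e.2 ≠ e'.2) :
    InjOn (fun z : ℝ × ℝ => f (edgeArc e z.1)) (crossingParameters f e e') := by
  rintro ⟨s, t⟩ ⟨⟨hs, ht⟩, h⟩ ⟨s', t'⟩ ⟨⟨hs', ht'⟩, h'⟩ heq
  simp only at hs ht h hs' ht' h' heq
  have e1 : edgeArc e s' = edgeArc e s :=
    (hf.eq_or_eq (edgeArc_ne_of_disjoint h1 h2 hs ht) h heq.symm).resolve_right
      (edgeArc_ne_of_disjoint h1 h2 hs' ht)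
  have e2 : edgeArc e' t' = edgeArc e' t :=
    (hf.eq_or_eq (edgeArc_ne_of_disjoint h1 h2 hs ht) h
      (h'.symm.trans heq.symm)).resolve_left (edgeArc_ne_of_disjoint h1 h2 hs ht').symm
  exact Prod.ext (edgeArc_eq hs' hs e1).1.symm (edgeArc_eq ht' ht e2).1.symm

theorem IsPlaneGenericImmersion.image_crossingParameters (hf : IsPlaneGenericImmersion f)
    {e e' : Fin 3 × Fin 3} (h1 : e.1 ≠ e'.1) (h2 : e.2 ≠ e'.2) :
    (fun z : ℝ × ℝ => f (edgeArc e z.1)) '' crossingParameters f e e' =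
      {p | IsCrossing f p e e'} := by
  ext p
  constructor
  · rintro ⟨⟨s, t⟩, ⟨⟨hs, ht⟩, h⟩, rfl⟩
    have hne := edgeArc_ne_of_disjoint h1 h2 hs ht
    exact ⟨s, hf.mem_Ioo hs hne h, t, hf.mem_Ioo ht hne.symm h.symm, hne, rfl, h.symm⟩
  · rintro ⟨s, hs, t, ht, -, hp, hp'⟩
    exact ⟨(s, t), ⟨⟨Ioo_subset_Icc_self hs, Ioo_subset_Icc_self ht⟩, hp.trans hp'.symm⟩, hp⟩

theorem IsPlaneGenericImmersion.finite_crossingParameters (hf : IsPlaneGenericImmersion f)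
    {e e' : Fin 3 × Fin 3} (h1 : e.1 ≠ e'.1) (h2 : e.2 ≠ e'.2) :
    (crossingParameters f e e').Finite := by
  refine Set.Finite.of_finite_image ?_ (hf.injOn_crossingParameters h1 h2)
  rw [hf.image_crossingParameters h1 h2]
  exact hf.finitely_many.subset fun p hp => IsCrossing.mem_crossings hp

theorem IsPlaneGenericImmersion.exists_injOn_edgeArc (hf : IsPlaneGenericImmersion f)
    (e : Fin 3 × Fin 3) {s : ℝ} (hs : s ∈ Ioo (0 : ℝ) 1) :
    ∃ U ∈ 𝓝 s, InjOn (fun x => f (edgeArc e x)) U := by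
  obtain ⟨U, hU, hi⟩ := hf.locally_injective (edgeArc e s)
  refine ⟨edgeArc e ⁻¹' U ∩ Ioo 0 1, inter_mem ((continuous_edgeArc e).continuousAt hU)
    (Ioo_mem_nhds hs.1 hs.2), fun x hx y hy h => ?_⟩
  exact (edgeArc_eq (Ioo_subset_Icc_self hx.2) (Ioo_subset_Icc_self hy.2) (hi hx.1 hy.1 h)).1

/-- The winding number associated to a pair of disjoint edges has the parity of the number of
their crossings. -/
theorem IsPlaneGenericImmersion.rectChange_edges (hf : IsPlaneGenericImmersion f)
    {e e' : Fin 3 × Fin 3} (h1 : e.1 ≠ e'.1) (h2 : e.2 ≠ e'.2) :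
    ∃ k : ℤ, rectChange (fun s t => toComplex (f (edgeArc e s)) - toComplex (f (edgeArc e' t)))
      0 1 0 1 = (2 * k + {p | IsCrossing f p e e'}.ncard : ℤ) * (2 * π * I) := by
  have hfin := hf.finite_crossingParameters h1 h2
  have hinj := hf.injOn_crossingParameters h1 h2
  have hcont : ∀ e, Continuous fun s => f (edgeArc e s) := fun e =>
    hf.continuous.comp (continuous_edgeArc e)
  have hcont' : ∀ e, Continuous fun s => toComplex (f (edgeArc e s)) := fun e =>
    toComplex.continuous.comp (hcont e)
  rw [← hf.image_crossingParameters h1 h2, hinj.ncard_image,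
    Set.ncard_eq_toFinset_card _ hfin]
  refine rectChange_eq_card
    (F := fun s t => toComplex (f (edgeArc e s)) - toComplex (f (edgeArc e' t))) (((hcont' e).comp continuous_fst).sub
    ((hcont' e').comp continuous_snd)) zero_le_one _ zero_le_one hfin.toFinset rfl ?_ ?_ ?_
  · intro z
    rw [Set.Finite.mem_toFinset, sub_eq_zero, toComplex.injective.eq_iff]
    rfl
  · intro z hz
    obtain ⟨⟨hs, ht⟩, h⟩ := hfin.mem_toFinset.1 hz
    have hne := edgeArc_ne_of_disjoint h1 h2 hs ht
    have hs' := hf.mem_Ioo hs hne h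
    have ht' := hf.mem_Ioo ht hne.symm h.symm
    obtain ⟨-, φ, hsrc, h0, hx, hy⟩ := hf.transversal _ _ hne h
    exact ⟨hs', ht', locallyOdd_of_transversal (hcont e) (hcont e') h
      (hf.exists_injOn_edgeArc e hs') (hf.exists_injOn_edgeArc e' ht') φ hsrc h0
      ((continuous_edgeArc e).continuousAt.eventually hx)
      ((continuous_edgeArc e').continuousAt.eventually hy)⟩
  · intro z hz w hw hzw
    rw [Set.Finite.coe_toFinset] at hz hw
    exact hinj hz hw (congrArg (fun s => f (edgeArc e s)) hzw)

theorem IsPlaneGenericImmersion.sum_crossings_odd (hf : IsPlaneGenericImmersion f) :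
    Odd (∑ e ∈ disjointPairs, {p | IsCrossing f p e.1 e.2}.ncard) := by
  have hd : ∀ e ∈ disjointPairs, e.1.1 ≠ e.2.1 ∧ e.1.2 ≠ e.2.2 := fun e he => by
    simp only [disjointPairs, Finset.mem_filter, Finset.mem_univ, true_and] at he
    exact ⟨he.1.ne, he.2⟩
  have hw : ∀ e, ∃ k : ℤ, e ∈ disjointPairs → rectChange (fun s t =>
      toComplex (f (edgeArc e.1 s)) - toComplex (f (edgeArc e.2 t))) 0 1 0 1 =
        (2 * k + {p | IsCrossing f p e.1 e.2}.ncard : ℤ) * (2 * π * I) := fun e => by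
    by_cases he : e ∈ disjointPairs
    · exact (hf.rectChange_edges (hd e he).1 (hd e he).2).imp fun k hk _ => hk
    · exact ⟨0, fun h => (he h).elim⟩
  choose k hk using hw
  have m0 : (0 : ℝ) ∈ Icc (0 : ℝ) 1 := ⟨le_rfl, zero_le_one⟩
  have m1 : (1 : ℝ) ∈ Icc (0 : ℝ) 1 := ⟨zero_le_one, le_rfl⟩
  have start : ∀ i j, edgeArc (i, j) 0 = edgeArc (i, 0) 0 := fun i j =>
    Subtype.ext (by rw [edgeArc_val m0, edgeArc_val m0, edgePoint_zero, edgePoint_zero])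
  have finish : ∀ i j, edgeArc (i, j) 1 = edgeArc (0, j) 1 := fun i j =>
    Subtype.ext (by rw [edgeArc_val m1, edgeArc_val m1, edgePoint_one, edgePoint_one])
  have hodd := sum_windings_odd (A := fun i j s => toComplex (f (edgeArc (i, j) s)))
    (p := fun i => toComplex (f (edgeArc (i, 0) 0))) (q := fun j => toComplex (f (edgeArc (0, j) 1)))
    (fun i j => toComplex.continuous.comp (hf.continuous.comp (continuous_edgeArc _)))
    (fun i j => by rw [start]) (fun i j => by rw [finish])
    -- A vertex whose image lay on that of an edge not ending there would be a multiple point.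
    (fun i j k hki s hs h => by
      have hne : edgeArc (k, 0) 0 ≠ edgeArc (i, j) s := fun h => by
        obtain ⟨-, h3, -⟩ := edgeArc_eq m0 hs h
        exact h3.elim zero_ne_one hki
      exact (hf.mem_Ioo m0 hne (toComplex.injective h.symm)).1.false)
    (fun i j l hlj s hs h => by
      have hne : edgeArc (0, l) 1 ≠ edgeArc (i, j) s := fun h => by
        obtain ⟨-, -, h3⟩ := edgeArc_eq m1 hs h
        exact h3.elim one_ne_zero hlj
      exact (hf.mem_Ioo m1 hne (toComplex.injective h.symm)).2.false)
    (w := fun e => 2 * k e + ({p | IsCrossing f p e.1 e.2}.ncard : ℤ))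
    (fun e he => hk e he)
  rw [Finset.sum_add_distrib, ← Finset.mul_sum, Int.odd_add] at hodd
  have := (hodd.not.1 (by simp))
  exact_mod_cast Int.not_even_iff_odd.1 this

open Classical in
/-- The number of crossings between disjoint edges is odd. -/
theorem IsPlaneGenericImmersion.odd_card_disjoint_crossings (hf : IsPlaneGenericImmersion f)
    {ε ε' : Plane → Fin 3 × Fin 3}
    (hε : ∀ p ∈ hf.finitely_many.toFinset, IsCrossing f p (ε p) (ε' p)) :
    Odd (hf.finitely_many.toFinset.filter
      fun p => (ε p).1 ≠ (ε' p).1 ∧ (ε p).2 ≠ (ε' p).2).card := by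
  set D := hf.finitely_many.toFinset.filter fun p => (ε p).1 ≠ (ε' p).1 ∧ (ε p).2 ≠ (ε' p).2
  -- Ordering the two edges by left endpoint selects the representative in `disjointPairs`, so the
  -- fibres of `σ` are the sets of crossings of the individual pairs.
  let σ : Plane → (Fin 3 × Fin 3) × (Fin 3 × Fin 3) := fun p =>
    if (ε p).1 < (ε' p).1 then (ε p, ε' p) else (ε' p, ε p)
  have hσ : ∀ p ∈ D, σ p ∈ disjointPairs ∧ IsCrossing f p (σ p).1 (σ p).2 := fun p hp => by
    obtain ⟨hp, h1, h2⟩ := Finset.mem_filter.1 hp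
    simp only [σ, disjointPairs, Finset.mem_filter, Finset.mem_univ, true_and]
    split_ifs with h
    · exact ⟨⟨h, h2⟩, hε p hp⟩
    · exact ⟨⟨lt_of_le_of_ne (not_lt.1 h) h1.symm, h2.symm⟩, (hε p hp).symm⟩
  rw [Finset.card_eq_sum_card_fiberwise (f := σ) (t := disjointPairs) fun p hp => (hσ p hp).1]
  convert hf.sum_crossings_odd using 3 with e he
  rw [← Set.ncard_coe_finset]
  congr 1
  ext p
  simp only [disjointPairs, Finset.mem_filter, Finset.mem_univ, true_and] at he
  rw [Finset.mem_coe, Finset.mem_filter]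
  constructor
  · rintro ⟨hp, rfl⟩
    exact (hσ p hp).2
  · intro hp
    have hp' := hf.finitely_many.mem_toFinset.2 hp.mem_crossings
    rcases hf.edges_unique (hε p hp') hp with ⟨h1, h2⟩ | ⟨h1, h2⟩
    · refine ⟨Finset.mem_filter.2 ⟨hp', by rw [← h1, ← h2]; exact ⟨he.1.ne, he.2⟩⟩, ?_⟩
      simp only [σ]
      rw [← h1, ← h2, if_pos he.1]
    · refine ⟨Finset.mem_filter.2 ⟨hp', by rw [← h1, ← h2]; exact ⟨he.1.ne', he.2.symm⟩⟩, ?_⟩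
      simp only [σ]
      rw [← h1, ← h2, if_neg he.1.not_gt]

/-- A family of cycles in which exactly the pairs of disjoint edges lie on an odd number of members
has an odd total number of crossings. -/
theorem IsPlaneGenericImmersion.odd_sum_crossingNumber (hf : IsPlaneGenericImmersion f)
    {𝒮 : Finset (Finset (Fin 3 × Fin 3))}
    (h𝒮 : ∀ e e' : Fin 3 × Fin 3,
      Odd (𝒮.filter fun S => e ∈ S ∧ e' ∈ S).card ↔ e.1 ≠ e'.1 ∧ e.2 ≠ e'.2) :
    Odd (∑ γ ∈ 𝒮.map edgeSetEmbedding, crossingNumber f γ) := by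
  classical
  have hex : ∀ p, ∃ e e', p ∈ hf.finitely_many.toFinset → IsCrossing f p e e' := fun p => by
    by_cases hp : p ∈ crossings f ⊤
    · obtain ⟨e, e', h⟩ := hf.exists_isCrossing hp
      exact ⟨e, e', fun _ => h⟩
    · exact ⟨0, 0, fun h => (hp (hf.finitely_many.mem_toFinset.1 h)).elim⟩
  choose ε ε' hε using hex
  have h1 : ∀ S, crossingNumber f (edgeSetEmbedding S) = (hf.finitely_many.toFinset.filter
      fun p => ε p ∈ S ∧ ε' p ∈ S).card := fun S => by
    rw [crossingNumber, ← Set.ncard_coe_finset]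
    congr 1
    ext p
    rw [Finset.mem_coe, Finset.mem_filter]
    constructor
    · intro hp
      have hp' := hf.finitely_many.mem_toFinset.2 (crossings_mono f _ hp)
      exact ⟨hp', (hf.mem_crossings_iff (hε p hp') S).1 hp⟩
    · exact fun ⟨hp, h⟩ => (hf.mem_crossings_iff (hε p hp) S).2 h
  -- Double counting of incidences between cycles and crossings.
  have h2 : ∑ S ∈ 𝒮, (hf.finitely_many.toFinset.filter fun p => ε p ∈ S ∧ ε' p ∈ S).card =
      ∑ p ∈ hf.finitely_many.toFinset, (𝒮.filter fun S => ε p ∈ S ∧ ε' p ∈ S).card :=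
    Finset.sum_card_bipartiteAbove_eq_sum_card_bipartiteBelow fun S p => ε p ∈ S ∧ ε' p ∈ S
  rw [Finset.sum_map, Finset.sum_congr rfl fun S _ => h1 S, h2,
    Finset.odd_sum_iff_odd_card_odd]
  simp only [h𝒮]
  exact hf.odd_card_disjoint_crossings hε

end Crossings

end PlaneImmersion

end

theorem theorem1p2
    (f : PlaneImmersion.graphSpace (completeBipartiteGraph (Fin 3) (Fin 3)) →
      PlaneImmersion.Plane)
    (hf : PlaneImmersion.IsPlaneGenericImmersion f) :
    Odd (∑ γ ∈ PlaneImmersion.cyclesOfLength (completeBipartiteGraph (Fin 3) (Fin 3)) 4,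
      PlaneImmersion.crossingNumber f γ) ∧
    Odd (∑ γ ∈ PlaneImmersion.cyclesOfLength (completeBipartiteGraph (Fin 3) (Fin 3)) 6,
      PlaneImmersion.crossingNumber f γ) := by
  rw [PlaneImmersion.cyclesOfLength_four, PlaneImmersion.cyclesOfLength_six]
  exact ⟨hf.odd_sum_crossingNumber PlaneImmersion.odd_card_fourCycles,
    hf.odd_sum_crossingNumber PlaneImmersion.odd_card_sixCycles⟩
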